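/- Let $K$ be a non-empty compact Hausdorff space, let $C(K)$ be the Banach lattice of continuous real-valued functions on $K$ with the supremum norm, and let $n\ge 1$ be an integer. A function $P\colon C(K)\to\mathbb{R}$ is an orthogonally additive $n$-homogeneous polynomial if there is a bounded $n$-linear form $A$ on $C(K)$ with $P(x)=A(x,\dots,x)$ for all $x\in C(K)$, and $P(x+y)=P(x)+P(y)$ whenever $|x|\wedge|y|=0$. Let $\mathcal{P}_o(^nC(K))$ be the vector space of all such $P$, with the norm $\|P\|_\infty=\sup\{|P(x)| : x\in C(K),\ \|x\|_\infty\le 1\}$. For $t\in K$ let $\delta_t^n\in\mathcal{P}_o(^nC(K))$ be given by $\delta_t^n(x)=x(t)^n$. (a) If $n$ is odd, then $P\in\mathcal{P}_o(^nC(K))$ is an extreme point of the closed unit ball of $(\mathcal{P}_o(^nC(K)),\|\cdot\|_\infty)$ if and only if $P=\pm\delta_t^n$ for some $t\in K$. (b) If $n$ is even, then $P\in\mathcal{P}_o(^nC(K))$ is an extreme point of the closed unit ball of $(\mathcal{P}_o(^nC(K)),\|\cdot\|_\infty)$ if and only if either $P=\pm\delta_t^n$ for some $t\in K$, or $P=\delta_s^n-\delta_t^n$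 for some distinct points $s,t\in K$. -/

import Mathlib

noncomputable section

/-- `P : E → ℝ` is a (bounded) `n`-homogeneous polynomial: `P x = A (x, …, x)` for some bounded
`n`-linear form `A` on `E`. -/
def IsHomogeneousPolynomial {E : Type*} [NormedAddCommGroup E] [NormedSpace ℝ E]
    (n : ℕ) (P : E → ℝ) : Prop :=
  ∃ A : ContinuousMultilinearMap ℝ (fun _ : Fin n => E) ℝ, ∀ x, P x = A (fun _ => x)

/-- `P` is additive on pairs of disjoint elements (`|x| ∧ |y| = 0`) of the vector lattice `E`. -/
def IsOrthogonallyAdditive {E : Type*} [AddCommGroup E] [Lattice E] (P : E → ℝ) : Prop :=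
  ∀ x y : E, |x| ⊓ |y| = 0 → P (x + y) = P x + P y

/-- The vector space of orthogonally additive `n`-homogeneous polynomials on `E`, as a space of
functions with pointwise operations. -/
def orthPolySubmodule (n : ℕ) (E : Type*) [NormedAddCommGroup E] [NormedSpace ℝ E] [Lattice E] :
    Submodule ℝ (E → ℝ) where
  carrier := {P | IsHomogeneousPolynomial n P ∧ IsOrthogonallyAdditive P}
  add_mem' := by
    rintro P Q ⟨⟨A, hA⟩, hP⟩ ⟨⟨B, hB⟩, hQ⟩
    refine ⟨⟨A + B, fun x => by simp [hA, hB]⟩, fun x y h => ?_⟩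
    simp only [Pi.add_apply, hP x y h, hQ x y h]
    ring
  zero_mem' := ⟨⟨0, fun x => by simp⟩, fun x y _ => by simp⟩
  smul_mem' := by
    rintro c P ⟨⟨A, hA⟩, hP⟩
    refine ⟨⟨c • A, fun x => by simp [hA]⟩, fun x y h => ?_⟩
    simp only [Pi.smul_apply, hP x y h, smul_eq_mul]
    ring

/-- The space of orthogonally additive `n`-homogeneous polynomials on `E`; it is given the
supremum norm below. -/
def OrthPoly (n : ℕ) (E : Type*) [NormedAddCommGroup E] [NormedSpace ℝ E] [Lattice E] : Type _ :=
  orthPolySubmodule n E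

namespace OrthPoly

section General

variable {n : ℕ} {E : Type*} [NormedAddCommGroup E] [NormedSpace ℝ E] [Lattice E]

instance : AddCommGroup (OrthPoly n E) := inferInstanceAs (AddCommGroup (orthPolySubmodule n E))

instance : Module ℝ (OrthPoly n E) := inferInstanceAs (Module ℝ (orthPolySubmodule n E))

instance : CoeFun (OrthPoly n E) (fun _ => E → ℝ) := ⟨fun P => P.1⟩

theorem ext {P Q : OrthPoly n E} (h : ∀ x, P x = Q x) : P = Q := Subtype.ext (funext h)

theorem add_apply (P Q : OrthPoly n E) (x : E) : (P + Q) x = P x + Q x := rfl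

theorem neg_apply (P : OrthPoly n E) (x : E) : (-P) x = -P x := rfl

theorem sub_apply (P Q : OrthPoly n E) (x : E) : (P - Q) x = P x - Q x := rfl

theorem smul_apply (c : ℝ) (P : OrthPoly n E) (x : E) : (c • P) x = c * P x := rfl

theorem zero_apply (x : E) : (0 : OrthPoly n E) x = 0 := rfl

/-- The supremum norm `‖P‖ = sup {|P x| : ‖x‖ ≤ 1}`. -/
instance : Norm (OrthPoly n E) := ⟨fun P => sSup {r : ℝ | ∃ x : E, ‖x‖ ≤ 1 ∧ r = |P x|}⟩

theorem norm_def (P : OrthPoly n E) :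
    ‖P‖ = sSup {r : ℝ | ∃ x : E, ‖x‖ ≤ 1 ∧ r = |P x|} := rfl

theorem bddAbove_values (P : OrthPoly n E) :
    BddAbove {r : ℝ | ∃ x : E, ‖x‖ ≤ 1 ∧ r = |P x|} := by
  obtain ⟨A, hA⟩ := P.2.1
  refine ⟨‖A‖, ?_⟩
  rintro r ⟨x, hx, rfl⟩
  rw [hA, ← Real.norm_eq_abs]
  refine (A.le_opNorm _).trans ?_
  refine mul_le_of_le_one_right (norm_nonneg _) ?_
  exact Finset.prod_le_one (fun _ _ => norm_nonneg _) (fun _ _ => hx)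

theorem abs_apply_le_norm (P : OrthPoly n E) {x : E} (hx : ‖x‖ ≤ 1) : |P x| ≤ ‖P‖ :=
  le_csSup P.bddAbove_values ⟨x, hx, rfl⟩

theorem norm_le {P : OrthPoly n E} {C : ℝ} (h : ∀ x : E, ‖x‖ ≤ 1 → |P x| ≤ C) : ‖P‖ ≤ C := by
  refine csSup_le ⟨|P 0|, 0, by simp, rfl⟩ ?_
  rintro r ⟨x, hx, rfl⟩
  exact h x hx

theorem apply_smul (P : OrthPoly n E) (c : ℝ) (x : E) : P (c • x) = c ^ n * P x := by
  obtain ⟨A, hA⟩ := P.2.1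
  rw [hA, hA]
  simpa using A.map_smul_univ (fun _ => c) (fun _ => x)

theorem norm_core : NormedSpace.Core ℝ (OrthPoly n E) where
  norm_nonneg P := (abs_nonneg _).trans (P.abs_apply_le_norm (x := 0) (by simp))
  norm_smul c P := by
    have key : ∀ (c : ℝ) (P : OrthPoly n E), ‖c • P‖ ≤ ‖c‖ * ‖P‖ := fun c P =>
      norm_le fun x hx => by
        rw [smul_apply, abs_mul, Real.norm_eq_abs]
        exact mul_le_mul_of_nonneg_left (P.abs_apply_le_norm hx) (abs_nonneg _)
    refine le_antisymm (key c P) ?_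
    rcases eq_or_ne c 0 with rfl | hc
    · simpa using (abs_nonneg _).trans
        (((0 : ℝ) • P).abs_apply_le_norm (x := 0) (by simp))
    · have h := key c⁻¹ (c • P)
      rw [smul_smul, inv_mul_cancel₀ hc, one_smul, norm_inv] at h
      rwa [← le_inv_mul_iff₀ (norm_pos_iff.2 hc)]
  norm_triangle P Q := norm_le fun x hx => by
    rw [add_apply]
    exact (abs_add_le _ _).trans (add_le_add (P.abs_apply_le_norm hx) (Q.abs_apply_le_norm hx))
  norm_eq_zero_iff P := by
    constructor
    · intro h
      have h1 : ∀ x : E, ‖x‖ ≤ 1 → P x = 0 := fun x hx =>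
        abs_nonpos_iff.1 ((P.abs_apply_le_norm hx).trans h.le)
      refine ext fun x => ?_
      rw [zero_apply]
      rcases eq_or_ne x 0 with rfl | hx
      · exact h1 0 (by simp)
      · have h2 : ‖‖x‖⁻¹ • x‖ ≤ 1 := by
          rw [norm_smul, norm_inv, norm_norm, inv_mul_cancel₀ (norm_ne_zero_iff.2 hx)]
        have h3 : x = ‖x‖ • ‖x‖⁻¹ • x := by
          rw [smul_smul, mul_inv_cancel₀ (norm_ne_zero_iff.2 hx), one_smul]
        rw [h3, apply_smul, h1 _ h2, mul_zero]
    · rintro rfl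
      refine le_antisymm (norm_le fun x _ => by simp [zero_apply]) ?_
      exact (abs_nonneg _).trans ((0 : OrthPoly n E).abs_apply_le_norm (x := 0) (by simp))

instance : NormedAddCommGroup (OrthPoly n E) := NormedAddCommGroup.ofCore norm_core

instance : NormedSpace ℝ (OrthPoly n E) := NormedSpace.ofCore norm_core

end General

/-- The polynomial `δ_t ^ n : x ↦ x(t) ^ n` on `C(K)`, for `n ≥ 1`. -/
def deltaPow {K : Type*} [TopologicalSpace K] [CompactSpace K] {n : ℕ} (hn : 0 < n) (t : K) :
    OrthPoly n C(K, ℝ) :=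
  ⟨fun x => x t ^ n,
    ⟨(ContinuousMultilinearMap.mkPiAlgebraFin ℝ n ℝ).compContinuousLinearMap
        (fun _ => ContinuousMap.evalCLM ℝ t), fun x => by simp⟩,
    fun x y h => by
      have h' : |x t| ⊓ |y t| = 0 := by
        simpa using congrArg (fun f : C(K, ℝ) => f t) h
      have h0 : x t = 0 ∨ y t = 0 := by
        rcases min_choice |x t| |y t| with hm | hm
        · exact Or.inl (abs_eq_zero.1 (hm.symm.trans h'))
        · exact Or.inr (abs_eq_zero.1 (hm.symm.trans h'))
      rcases h0 with h0 | h0 <;> simp [h0, hn.ne']⟩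

theorem deltaPow_apply {K : Type*} [TopologicalSpace K] [CompactSpace K] {n : ℕ} (hn : 0 < n)
    (t : K) (x : C(K, ℝ)) : deltaPow hn t x = x t ^ n := rfl

end OrthPoly

end

/-! Every orthogonally additive P is P(x) = φ(xⁿ) for a unique bounded functional φ, so the question
concerns extreme points of sets of functionals. As x runs over the unit ball, xⁿ fills the unit ball
when n is odd, but only the order interval [0, 1] when n is even. The ball of polynomials thus
becomes `dualBall K` or the larger set `intervalPolar K`.

For the representation, polarization and a partition of unity show that the symmetrized form
vanishes once two arguments are disjoint (`symmSum_eq_zero_of_mul_eq_zero`). A bounded bilinear form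
with this property depends only on the product (`bilinear_eq_apply_mul_one`), so all factors can be
collected in one slot.

The extreme points are found without measures. Split φ as hφ + (1 - h)φ with 0 ≤ h ≤ 1; extremality
makes hφ proportional to φ, so φ is a multiple of a character, that is, of a point evaluation
(`exists_eq_smul_eval`). This applies directly to the dual ball. In the polar, φ = α - β with α, β
positive of mass at most 1; each is extreme among positive functionals of its own mass, hence a
multiple of an evaluation, and both masses must be 0 or 1. -/

/-! ### Polarization and symmetrization -/

open Finset in
theorem Finset.sum_neg_one_pow_card_mul_eq_zero {ι : Type*} [Fintype ι] [DecidableEq ι] (j : ι)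
    (F : Finset ι → ℝ) (hF : ∀ T, j ∉ T → F (insert j T) = F T) :
    ∑ T : Finset ι, (-1 : ℝ) ^ #T * F T = 0 := by
  -- Subsets pair off as T and `insert j T`, with opposite signs.
  have h1 : (Finset.univ : Finset (Finset ι)) = (insert j (univ.erase j)).powerset := by
    rw [insert_erase (mem_univ j), powerset_univ]
  rw [h1, sum_powerset_insert (notMem_erase j _), ← sum_add_distrib]
  refine sum_eq_zero fun T hT => ?_
  have hj : j ∉ T := fun h => notMem_erase j _ (mem_powerset.1 hT h)
  rw [hF T hj, card_insert_of_notMem hj, pow_succ]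
  ring

open Finset in
/-- Polarization formula for a multilinear form on the diagonal. -/
theorem MultilinearMap.polarization {ι E : Type*} [Fintype ι] [DecidableEq ι] [AddCommGroup E]
    [Module ℝ E] (A : MultilinearMap ℝ (fun _ : ι => E) ℝ) (v : ι → E) :
    ∑ T : Finset ι, (-1 : ℝ) ^ #T * A (fun _ => ∑ i ∈ T, v i) =
      (-1) ^ Fintype.card ι * ∑ σ : Equiv.Perm ι, A (fun i => v (σ i)) := by
  have h1 : ∀ T : Finset ι, A (fun _ => ∑ i ∈ T, v i) =
      ∑ r : ι → ι, if ∀ i, r i ∈ T then A (fun i => v (r i)) else 0 := fun T => by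
    rw [A.map_sum_finset (fun _ i => v i) (fun _ => T), ← sum_filter]
    congr 1
    ext r
    simp
  -- If r misses an index j, its contribution does not depend on whether j ∈ T and cancels; only
  -- permutations survive.
  have h2 : ∀ r : ι → ι, ∑ T : Finset ι, (-1 : ℝ) ^ #T *
      (if ∀ i, r i ∈ T then A (fun i => v (r i)) else 0) =
      if Function.Bijective r then (-1) ^ Fintype.card ι * A (fun i => v (r i)) else 0 := by
    intro r
    split_ifs with hr
    · rw [sum_eq_single univ]
      · simp
      · intro T _ hT
        rw [if_neg, mul_zero]
        intro h
        refine hT (eq_univ_of_forall fun i => ?_)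
        obtain ⟨k, rfl⟩ := hr.2 i
        exact h k
      · simp
    · rw [← Finite.surjective_iff_bijective] at hr
      simp only [Function.Surjective, not_forall, not_exists] at hr
      obtain ⟨j, hj⟩ := hr
      refine sum_neg_one_pow_card_mul_eq_zero j _ fun T _ => ?_
      simp only [mem_insert, hj, false_or]
  simp_rw [h1, mul_sum]
  rw [sum_comm]
  simp_rw [← mul_sum, h2]
  rw [← sum_filter, ← mul_sum]
  congr 1
  exact (sum_bij (fun (σ : Equiv.Perm ι) _ => (σ : ι → ι))
    (fun σ _ => by simp)
    (fun _ _ _ _ h => DFunLike.coe_injective h)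
    (fun r hr => ⟨Equiv.ofBijective r (mem_filter.1 hr).2, mem_univ _, rfl⟩)
    (fun _ _ => rfl)).symm

/-- The symmetrization `∑ σ, A ∘ σ` of a continuous multilinear form. -/
noncomputable def ContinuousMultilinearMap.symmSum {ι E : Type*} [Fintype ι] [DecidableEq ι]
    [NormedAddCommGroup E] [NormedSpace ℝ E] (A : ContinuousMultilinearMap ℝ (fun _ : ι => E) ℝ) :
    ContinuousMultilinearMap ℝ (fun _ : ι => E) ℝ :=
  ∑ σ : Equiv.Perm ι, A.domDomCongr σ

section SymmSum

variable {ι E : Type*} [Fintype ι] [DecidableEq ι] [NormedAddCommGroup E] [NormedSpace ℝ E]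
  (A : ContinuousMultilinearMap ℝ (fun _ : ι => E) ℝ)

theorem ContinuousMultilinearMap.symmSum_apply (v : ι → E) :
    A.symmSum v = ∑ σ : Equiv.Perm ι, A (fun i => v (σ i)) := by
  simp [symmSum]

theorem ContinuousMultilinearMap.symmSum_diag (x : E) :
    A.symmSum (fun _ => x) = (Fintype.card ι).factorial * A (fun _ => x) := by
  simp [symmSum_apply, Fintype.card_perm]

end SymmSum

open Finset in
/-- The symmetrization of a form representing an orthogonally additive polynomial vanishes on
families that split into two non-trivial mutually disjoint groups. -/
theorem symmSum_eq_zero_of_split {ι K : Type*} [Fintype ι] [DecidableEq ι] [TopologicalSpace K]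
    [CompactSpace K] (A : ContinuousMultilinearMap ℝ (fun _ : ι => C(K, ℝ)) ℝ)
    (hA : IsOrthogonallyAdditive fun x => A fun _ => x) (v : ι → C(K, ℝ)) (S : Finset ι)
    {a b : ι} (ha : a ∈ S) (hb : b ∉ S) (hv : ∀ i ∈ S, ∀ j ∉ S, v i * v j = 0) :
    A.symmSum v = 0 := by
  have key : ∀ T : Finset ι, A (fun _ => ∑ i ∈ T, v i) =
      A (fun _ => ∑ i ∈ T ∩ S, v i) + A (fun _ => ∑ i ∈ T \ S, v i) := by
    intro T
    have h0 : (∑ i ∈ T ∩ S, v i) * (∑ i ∈ T \ S, v i) = 0 := by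
      rw [sum_mul_sum]
      exact sum_eq_zero fun i hi => sum_eq_zero fun j hj =>
        hv i (mem_inter.1 hi).2 j (mem_sdiff.1 hj).2
    have h := hA (∑ i ∈ T ∩ S, v i) (∑ i ∈ T \ S, v i) (by
      ext t
      have ht := congrArg (fun f : C(K, ℝ) => f t) h0
      simp only [ContinuousMap.mul_apply, ContinuousMap.zero_apply, mul_eq_zero] at ht
      simp only [ContinuousMap.inf_apply, ContinuousMap.abs_apply, ContinuousMap.zero_apply]
      rcases ht with ht | ht <;> simp [ht])
    simp only [sum_inter_add_sum_sdiff] at h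
    exact h
  have hp := A.toMultilinearMap.polarization v
  simp only [ContinuousMultilinearMap.coe_coe] at hp
  rw [A.symmSum_apply]
  -- The T ∩ S part ignores whether b ∈ T and the T \ S part ignores whether a ∈ T, so both
  -- alternating sums vanish.
  rw [sum_congr rfl fun T _ => by rw [key T, mul_add], sum_add_distrib,
    sum_neg_one_pow_card_mul_eq_zero b
      (fun T => A (fun _ => ∑ i ∈ T ∩ S, v i)) (fun T _ => by rw [insert_inter_of_notMem hb]),
    sum_neg_one_pow_card_mul_eq_zero a
      (fun T => A (fun _ => ∑ i ∈ T \ S, v i)) (fun T _ => by rw [insert_sdiff_of_mem _ ha]),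
    add_zero] at hp
  have h1 : ((-1 : ℝ) ^ Fintype.card ι) ≠ 0 := by simp
  exact (mul_eq_zero.1 hp.symm).resolve_left h1

theorem eq_zero_of_forall_abs_le_mul {a C : ℝ} (h : ∀ ε : ℝ, 0 < ε → |a| ≤ C * ε) : a = 0 := by
  by_contra ha
  have ha' : 0 < |a| := abs_pos.2 ha
  have hC : 0 < |C| + 1 := by positivity
  have h1 := h (|a| / (2 * (|C| + 1))) (by positivity)
  have h2 : C * (|a| / (2 * (|C| + 1))) ≤ (|C| + 1) * (|a| / (2 * (|C| + 1))) :=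
    mul_le_mul_of_nonneg_right ((le_abs_self C).trans (by linarith)) (by positivity)
  have h3 : (|C| + 1) * (|a| / (2 * (|C| + 1))) = |a| / 2 := by field_simp
  linarith

/-! ### Piecewise linear partitions of unity on the line -/

/-- The ramp function `x ↦ 0 ⊔ (1 ⊓ x)`. -/
def ramp (x : ℝ) : ℝ := max 0 (min 1 x)

/-- The hat function supported on `[-1, 1]`. -/
def hat (x : ℝ) : ℝ := ramp (x + 1) - ramp x

theorem continuous_ramp : Continuous ramp := by unfold ramp; fun_prop

theorem continuous_hat : Continuous hat := by
  unfold hat; exact (continuous_ramp.comp (by fun_prop)).sub continuous_ramp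

theorem ramp_nonneg (x : ℝ) : 0 ≤ ramp x := le_max_left _ _

theorem ramp_le_one (x : ℝ) : ramp x ≤ 1 := max_le zero_le_one (min_le_left _ _)

theorem ramp_of_nonpos {x : ℝ} (h : x ≤ 0) : ramp x = 0 := by
  unfold ramp; rw [min_eq_right (by linarith), max_eq_left h]

theorem ramp_of_one_le {x : ℝ} (h : 1 ≤ x) : ramp x = 1 := by
  unfold ramp; rw [min_eq_left h, max_eq_right zero_le_one]

theorem ramp_mono : Monotone ramp := fun _ _ h => max_le_max le_rfl (min_le_min le_rfl h)

theorem hat_nonneg (x : ℝ) : 0 ≤ hat x := sub_nonneg.2 (ramp_mono (by linarith))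

theorem hat_eq_zero {x : ℝ} (h : 1 ≤ |x|) : hat x = 0 := by
  unfold hat
  rcases le_abs.1 h with h | h
  · rw [ramp_of_one_le h, ramp_of_one_le (by linarith), sub_self]
  · rw [ramp_of_nonpos (by linarith), ramp_of_nonpos (by linarith), sub_self]

/-- A telescoping sum. It makes the integer translates of `hat` a partition of unity on [0, N]. -/
theorem sum_hat (N : ℕ) (y : ℝ) :
    ∑ i ∈ Finset.range (N + 1), hat (y - i) = ramp (y + 1) - ramp (y - N) := by
  induction N with
  | zero => simp [hat]
  | succ k ih =>
    rw [Finset.sum_range_succ, ih, hat]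
    push_cast
    rw [show y - ((k : ℝ) + 1) + 1 = y - k by ring]
    ring

theorem sum_hat_eq_one {N : ℕ} {y : ℝ} (h0 : 0 ≤ y) (hN : y ≤ N) :
    ∑ i ∈ Finset.range (N + 1), hat (y - i) = 1 := by
  rw [sum_hat, ramp_of_one_le (by linarith), ramp_of_nonpos (by linarith), sub_zero]

theorem sum_hat_le_one (N : ℕ) (y : ℝ) : ∑ i ∈ Finset.range (N + 1), hat (y - i) ≤ 1 := by
  rw [sum_hat]
  linarith [ramp_le_one (y + 1), ramp_nonneg (y - N)]

/-- A plateau function, equal to `1` on `[-1, 1]` and supported on `[-2, 2]`. -/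
def plateau (x : ℝ) : ℝ := hat (x + 1) + hat x + hat (x - 1)

theorem continuous_plateau : Continuous plateau := by
  unfold plateau
  exact ((continuous_hat.comp (by fun_prop)).add continuous_hat).add
    (continuous_hat.comp (by fun_prop))

theorem plateau_nonneg (x : ℝ) : 0 ≤ plateau x :=
  add_nonneg (add_nonneg (hat_nonneg _) (hat_nonneg _)) (hat_nonneg _)

theorem plateau_eq (x : ℝ) : plateau x = ramp (x + 2) - ramp (x - 1) := by
  unfold plateau hat
  rw [show x + 1 + 1 = x + 2 by ring, show x - 1 + 1 = x by ring]
  ring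

theorem plateau_eq_one {x : ℝ} (h : |x| ≤ 1) : plateau x = 1 := by
  have := abs_le.1 h
  rw [plateau_eq, ramp_of_one_le (by linarith), ramp_of_nonpos (by linarith), sub_zero]

theorem abs_mul_plateau_le (x : ℝ) : |x * plateau x| ≤ 2 * plateau x := by
  rw [abs_mul, abs_of_nonneg (plateau_nonneg x)]
  rcases le_or_gt |x| 2 with h | h
  · exact mul_le_mul_of_nonneg_right h (plateau_nonneg x)
  · have : plateau x = 0 := by
      rw [plateau_eq]
      rcases lt_abs.1 h with h | h
      · rw [ramp_of_one_le (by linarith), ramp_of_one_le (by linarith), sub_self]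
      · rw [ramp_of_nonpos (by linarith), ramp_of_nonpos (by linarith), sub_self]
    simp [this]

theorem sum_plateau_le (N : ℕ) (y : ℝ) :
    ∑ i ∈ Finset.range (N + 1), plateau (y - i) ≤ 3 := by
  unfold plateau
  simp_rw [Finset.sum_add_distrib, show ∀ i : ℝ, y - i + 1 = (y + 1) - i from fun i => by ring,
    show ∀ i : ℝ, y - i - 1 = (y - 1) - i from fun i => by ring]
  linarith [sum_hat_le_one N (y + 1), sum_hat_le_one N y, sum_hat_le_one N (y - 1)]

/-! ### Bilinear forms vanishing on disjoint pairs -/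

section Bilinear

variable {K : Type*} [TopologicalSpace K]

/-- A bounded bilinear form on `C(K)` dominates its diagonal sums, by a choice of signs. -/
theorem exists_sum_le_apply {ι : Type*} (C : C(K, ℝ) →ₗ[ℝ] C(K, ℝ) →ₗ[ℝ] ℝ) (s : Finset ι)
    (u w : ι → C(K, ℝ)) :
    ∃ U W : C(K, ℝ), (∀ t, |U t| ≤ ∑ i ∈ s, |u i t|) ∧ (∀ t, |W t| ≤ ∑ i ∈ s, |w i t|) ∧
      ∑ i ∈ s, C (u i) (w i) ≤ C U W := by
  classical
  induction s using Finset.induction_on with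
  | empty => exact ⟨0, 0, by simp, by simp, by simp⟩
  | insert a s ha ih =>
    obtain ⟨U, W, hU, hW, h⟩ := ih
    simp only [Finset.sum_insert ha]
    -- The cross terms cancel on averaging over the sign, so one of the two signs does at least as
    -- well as the average.
    have h2 : C (U + u a) (W + w a) + C (U - u a) (W - w a) =
        2 * C U W + 2 * C (u a) (w a) := by
      simp only [map_add, map_sub, LinearMap.add_apply, LinearMap.sub_apply]
      ring
    rcases le_total (C (U - u a) (W - w a)) (C (U + u a) (W + w a)) with h3 | h3
    · refine ⟨U + u a, W + w a, fun t => ?_, fun t => ?_, by linarith⟩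
      · rw [ContinuousMap.add_apply]
        linarith [abs_add_le (U t) (u a t), hU t]
      · rw [ContinuousMap.add_apply]
        linarith [abs_add_le (W t) (w a t), hW t]
    · refine ⟨U - u a, W - w a, fun t => ?_, fun t => ?_, by linarith⟩
      · rw [ContinuousMap.sub_apply]
        linarith [abs_sub (U t) (u a t), hU t]
      · rw [ContinuousMap.sub_apply]
        linarith [abs_sub (W t) (w a t), hW t]

variable [CompactSpace K]

/-- The bound is independent of the number of terms, so partitions may be refined without loss. -/
theorem abs_sum_apply_le {ι : Type*} (C : C(K, ℝ) →ₗ[ℝ] C(K, ℝ) →ₗ[ℝ] ℝ) {c : ℝ} (hc : 0 ≤ c)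
    (hC : ∀ f g, |C f g| ≤ c * ‖f‖ * ‖g‖) (s : Finset ι) (u w : ι → C(K, ℝ)) {a b : ℝ}
    (ha : 0 ≤ a) (hb : 0 ≤ b) (hu : ∀ t, ∑ i ∈ s, |u i t| ≤ a) (hw : ∀ t, ∑ i ∈ s, |w i t| ≤ b) :
    |∑ i ∈ s, C (u i) (w i)| ≤ c * a * b := by
  have key : ∀ w : ι → C(K, ℝ), (∀ t, ∑ i ∈ s, |w i t| ≤ b) →
      ∑ i ∈ s, C (u i) (w i) ≤ c * a * b := by
    intro w hw
    obtain ⟨U, W, hU, hW, h⟩ := exists_sum_le_apply C s u w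
    have hU' : ‖U‖ ≤ a := (ContinuousMap.norm_le _ ha).2 fun t => (hU t).trans (hu t)
    have hW' : ‖W‖ ≤ b := (ContinuousMap.norm_le _ hb).2 fun t => (hW t).trans (hw t)
    calc _ ≤ C U W := h
      _ ≤ |C U W| := le_abs_self _
      _ ≤ c * ‖U‖ * ‖W‖ := hC _ _
      _ ≤ c * a * b := by gcongr
  refine abs_le.2 ⟨?_, key w hw⟩
  have := key (fun i => -w i) (by simpa using hw)
  simp only [map_neg, Finset.sum_neg_distrib] at this
  linarith

/-- A bounded bilinear form on `C(K)` that vanishes on disjoint pairs depends only on the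
product. -/
theorem bilinear_eq_apply_mul_one (C : C(K, ℝ) →ₗ[ℝ] C(K, ℝ) →ₗ[ℝ] ℝ) {c : ℝ} (hc : 0 ≤ c)
    (hC : ∀ f g, |C f g| ≤ c * ‖f‖ * ‖g‖) (h0 : ∀ f g, f * g = 0 → C f g = 0)
    (f g : C(K, ℝ)) : C f g = C (f * g) 1 := by
  rw [← sub_eq_zero]
  -- 7 = 6 + 1: the truncated remainders `w i` cost 6ε, and replacing g by the local constants `k i`
  -- costs ε.
  refine eq_zero_of_forall_abs_le_mul (C := 7 * c * ‖f‖) fun ε hε => ?_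
  obtain ⟨M, hM⟩ := exists_nat_ge (‖g‖ / ε)
  -- The range of g is rescaled to mesh 1 and shifted into [0, 2M]. Then `u i` lives where g is
  -- within ε of `k i`, and `w i` is g - `k i` cut off away from there, which keeps ∑ |`w i`| small.
  let y : C(K, ℝ) := ⟨fun t => g t / ε + M, by fun_prop⟩
  have hy : ∀ t, 0 ≤ y t ∧ y t ≤ (2 * M : ℕ) := by
    intro t
    have h1 : |g t| ≤ ‖g‖ := g.norm_coe_le_norm t
    have h2 : |g t / ε| ≤ M := by
      rw [abs_div, abs_of_pos hε]
      exact (div_le_div_of_nonneg_right h1 hε.le).trans hM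
    have := abs_le.1 h2
    simp only [y, ContinuousMap.coe_mk]
    push_cast
    constructor <;> linarith
  let s := Finset.range (2 * M + 1)
  let p : ℕ → C(K, ℝ) := fun i => ⟨fun t => hat (y t - i), continuous_hat.comp (by fun_prop)⟩
  let u : ℕ → C(K, ℝ) := fun i => f * p i
  let w : ℕ → C(K, ℝ) := fun i => ⟨fun t => ε * ((y t - i) * plateau (y t - i)),
    continuous_const.mul (.mul (by fun_prop) (continuous_plateau.comp (by fun_prop)))⟩
  let k : ℕ → ℝ := fun i => ε * (i - M)
  have hp : ∑ i ∈ s, p i = 1 := by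
    ext t
    simpa [p, s] using sum_hat_eq_one (hy t).1 (hy t).2
  have hu : ∑ i ∈ s, u i = f := by
    simp only [u]
    rw [← Finset.mul_sum, hp, mul_one]
  have hgk : ∀ i t, g t - k i = ε * (y t - i) := by
    intro i t
    simp only [k, y, ContinuousMap.coe_mk]
    field_simp
    ring
  have h1 : ∀ i, C (u i) g = C (u i) (w i) + k i * C (u i) 1 := by
    intro i
    -- The plateau is 1 wherever the hat is nonzero.
    have h2 : u i * (g - k i • 1 - w i) = 0 := by
      ext t
      have h3 := hgk i t
      simp only [u, p, w, ContinuousMap.mul_apply, ContinuousMap.sub_apply,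
        ContinuousMap.smul_apply, ContinuousMap.one_apply, smul_eq_mul, mul_one,
        ContinuousMap.coe_mk, ContinuousMap.zero_apply, h3]
      rcases le_total 1 |y t - i| with h4 | h4
      · rw [hat_eq_zero h4]; ring
      · rw [plateau_eq_one h4]; ring
    have h3 := h0 _ _ h2
    simp only [map_sub, map_smul, smul_eq_mul] at h3
    linarith
  have h2 : C f g - C (f * g) 1 =
      ∑ i ∈ s, C (u i) (w i) - C (∑ i ∈ s, u i * (g - k i • 1)) 1 := by
    have e1 : C f g = ∑ i ∈ s, C (u i) g := by
      conv_lhs => rw [← hu]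
      rw [map_sum, LinearMap.sum_apply]
    have e2 : ∑ i ∈ s, u i * (g - k i • 1) = f * g - ∑ i ∈ s, k i • u i := by
      simp only [mul_sub, Finset.sum_sub_distrib, mul_smul_comm, mul_one]
      rw [← Finset.sum_mul, hu]
    rw [e1, e2, map_sub, LinearMap.sub_apply, map_sum, LinearMap.sum_apply]
    simp only [h1, Finset.sum_add_distrib, map_smul, LinearMap.smul_apply, smul_eq_mul]
    ring
  have hus : ∀ t, ∑ i ∈ s, |u i t| ≤ ‖f‖ := by
    intro t
    simp only [u, p, ContinuousMap.mul_apply, ContinuousMap.coe_mk, abs_mul,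
      abs_of_nonneg (hat_nonneg _)]
    rw [← Finset.mul_sum, sum_hat_eq_one (hy t).1 (hy t).2, mul_one]
    exact f.norm_coe_le_norm t
  have hws : ∀ t, ∑ i ∈ s, |w i t| ≤ 6 * ε := by
    intro t
    calc ∑ i ∈ s, |w i t| ≤ ∑ i ∈ s, ε * (2 * plateau (y t - i)) := by
          refine Finset.sum_le_sum fun i _ => ?_
          simp only [w, ContinuousMap.coe_mk]
          rw [abs_mul, abs_of_pos hε]
          exact mul_le_mul_of_nonneg_left (abs_mul_plateau_le _) hε.le
      _ = 2 * ε * ∑ i ∈ s, plateau (y t - i) := by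
          rw [Finset.mul_sum]; exact Finset.sum_congr rfl fun _ _ => by ring
      _ ≤ 2 * ε * 3 := mul_le_mul_of_nonneg_left (sum_plateau_le _ _) (by positivity)
      _ = 6 * ε := by ring
  have h3 : ‖∑ i ∈ s, u i * (g - k i • 1)‖ ≤ ‖f‖ * ε := by
    refine (ContinuousMap.norm_le _ (by positivity)).2 fun t => ?_
    rw [ContinuousMap.sum_apply, Real.norm_eq_abs]
    calc _ ≤ ∑ i ∈ s, |(u i * (g - k i • 1)) t| := Finset.abs_sum_le_sum_abs _ _
      _ ≤ ∑ i ∈ s, |u i t| * ε := by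
          refine Finset.sum_le_sum fun i _ => ?_
          have h4 := hgk i t
          simp only [u, p, ContinuousMap.mul_apply, ContinuousMap.sub_apply,
            ContinuousMap.smul_apply, ContinuousMap.one_apply, smul_eq_mul, mul_one,
            ContinuousMap.coe_mk, h4, abs_mul, abs_of_pos hε]
          rcases le_total 1 |y t - i| with h5 | h5
          · rw [hat_eq_zero h5]; simp
          · exact mul_le_mul_of_nonneg_left (mul_le_of_le_one_right hε.le h5) (by positivity)
      _ = (∑ i ∈ s, |u i t|) * ε := by rw [Finset.sum_mul]
      _ ≤ ‖f‖ * ε := mul_le_mul_of_nonneg_right (hus t) hε.le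
  have h4 := abs_sum_apply_le C hc hC s u w (norm_nonneg f) (by positivity) hus hws
  have hone : ‖(1 : C(K, ℝ))‖ ≤ 1 := (ContinuousMap.norm_le _ zero_le_one).2 fun t => by simp
  have h5 : |C (∑ i ∈ s, u i * (g - k i • 1)) 1| ≤ c * (‖f‖ * ε) * 1 :=
    (hC _ _).trans (by gcongr)
  rw [h2]
  linarith [abs_sub (∑ i ∈ s, C (u i) (w i)) (C (∑ i ∈ s, u i * (g - k i • 1)) 1)]

end Bilinear

/-! ### Collecting all arguments in one slot -/

section Representation

variable {ι K : Type*} [Fintype ι] [DecidableEq ι] [TopologicalSpace K] [CompactSpace K]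
  (A : ContinuousMultilinearMap ℝ (fun _ : ι => C(K, ℝ)) ℝ)

-- Cut every argument along the n + 1 levels of y, n being the number of slots. In the expansion `v
-- a` survives only at the top level and `v b` only at level 0. Some intermediate level is unused,
-- and it splits the slots into two disjoint groups.
open Finset in
theorem symmSum_eq_zero_of_separated (hA : IsOrthogonallyAdditive fun x => A fun _ => x)
    (v : ι → C(K, ℝ)) {a b : ι} (y : C(K, ℝ)) (hy0 : ∀ t, 0 ≤ y t)
    (hy1 : ∀ t, y t ≤ Fintype.card ι) (ha : ∀ t, v a t ≠ 0 → y t = Fintype.card ι)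
    (hb : ∀ t, v b t ≠ 0 → y t = 0) : A.symmSum v = 0 := by
  let n := Fintype.card ι
  let p : Fin (n + 1) → C(K, ℝ) := fun m =>
    ⟨fun t => hat (y t - (m : ℕ)), continuous_hat.comp (by fun_prop)⟩
  have hp : ∑ m, p m = 1 := by
    ext t
    have := sum_hat_eq_one (hy0 t) (hy1 t)
    rw [← Fin.sum_univ_eq_sum_range (fun i : ℕ => hat (y t - i))] at this
    simpa [p, n] using this
  have hv : v = fun k => ∑ m, p m * v k := by
    funext k
    rw [← Finset.sum_mul, hp, one_mul]
  have hpp : ∀ i j k : Fin (n + 1), i < k → k < j → p i * p j = 0 := by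
    intro i j k hik hkj
    ext t
    have h1 : ((i : ℕ) : ℝ) + 1 ≤ (k : ℕ) := by exact_mod_cast hik
    have h2 : ((k : ℕ) : ℝ) + 1 ≤ (j : ℕ) := by exact_mod_cast hkj
    simp only [p, ContinuousMap.mul_apply, ContinuousMap.coe_mk, ContinuousMap.zero_apply]
    rcases le_total (y t) (k : ℕ) with h | h
    · rw [hat_eq_zero (x := y t - (j : ℕ)) (by rw [le_abs]; right; linarith), mul_zero]
    · rw [hat_eq_zero (x := y t - (i : ℕ)) (by rw [le_abs]; left; linarith), zero_mul]
  have hpa : ∀ m : Fin (n + 1), m ≠ Fin.last n → p m * v a = 0 := by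
    intro m hm
    ext t
    have h1 : ((m : ℕ) : ℝ) + 1 ≤ n := by exact_mod_cast Fin.lt_last_iff_ne_last.2 hm
    by_cases h : v a t = 0
    · simp [h]
    · simp only [p, ContinuousMap.mul_apply, ContinuousMap.coe_mk, ContinuousMap.zero_apply, ha t h]
      rw [hat_eq_zero (by rw [le_abs]; left; linarith), zero_mul]
  have hpb : ∀ m : Fin (n + 1), m ≠ 0 → p m * v b = 0 := by
    intro m hm
    ext t
    have h1 : (1 : ℝ) ≤ (m : ℕ) := by exact_mod_cast Fin.pos_iff_ne_zero.2 hm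
    by_cases h : v b t = 0
    · simp [h]
    · simp only [p, ContinuousMap.mul_apply, ContinuousMap.coe_mk, ContinuousMap.zero_apply, hb t h]
      rw [hat_eq_zero (by rw [le_abs]; right; linarith), zero_mul]
  rw [hv, A.symmSum.map_sum]
  refine sum_eq_zero fun r _ => ?_
  by_cases h1 : r a = Fin.last n
  swap
  · exact A.symmSum.map_coord_zero a (hpa _ h1)
  by_cases h2 : r b = 0
  swap
  · exact A.symmSum.map_coord_zero b (hpb _ h2)
  -- n slots cannot occupy n + 1 levels; hats on opposite sides of the gap m are disjoint.
  obtain ⟨m, hm⟩ : ∃ m, ∀ k, r k ≠ m := by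
    by_contra! h
    have := Fintype.card_le_of_surjective r h
    simp [n] at this
  refine symmSum_eq_zero_of_split A hA _ {k | r k < m} (a := b) (b := a) ?_ ?_ ?_
  · simp only [mem_filter, mem_univ, true_and, h2]
    exact Fin.pos_iff_ne_zero.2 fun h => hm b (h2.trans h.symm)
  · simp only [mem_filter, mem_univ, true_and, h1, not_lt]
    exact Fin.le_last m
  · intro i hi j hj
    simp only [mem_filter, mem_univ, true_and, not_lt] at hi hj
    rw [mul_mul_mul_comm, hpp _ _ m hi (lt_of_le_of_ne hj (hm j).symm), zero_mul]

/-- Subtracting the truncation q of `v a` at ±ε leaves a function living on |`v a`| ≥ ε, while `v b`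
lives on `v a` = 0. The function y separates these sets, and q costs at most ‖L‖ε. -/
theorem symmSum_eq_zero_of_mul_eq_zero (hA : IsOrthogonallyAdditive fun x => A fun _ => x)
    (v : ι → C(K, ℝ)) {a b : ι} (hab : a ≠ b) (hv : v a * v b = 0) : A.symmSum v = 0 := by
  let L := A.symmSum.toContinuousLinearMap v a
  have hL : L (v a) = A.symmSum v := by
    simp [L, ContinuousMultilinearMap.toContinuousLinearMap]
  rw [← hL]
  refine eq_zero_of_forall_abs_le_mul (C := ‖L‖) fun ε hε => ?_
  let q : C(K, ℝ) := ⟨fun t => max (-ε) (min ε (v a t)), by fun_prop⟩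
  let y : C(K, ℝ) := ⟨fun t => Fintype.card ι * min 1 (|v a t| / ε), by fun_prop⟩
  have h0 : L (v a - q) = 0 := by
    refine symmSum_eq_zero_of_separated A hA (Function.update v a (v a - q)) (a := a) (b := b) y
      (fun t => ?_) (fun t => ?_) (fun t ht => ?_) (fun t ht => ?_)
    · simp only [y, ContinuousMap.coe_mk]; positivity
    · exact mul_le_of_le_one_right (by positivity) (min_le_left _ _)
    · rw [Function.update_self] at ht
      simp only [y, ContinuousMap.coe_mk]
      rw [min_eq_left, mul_one]
      rw [le_div_iff₀ hε, one_mul]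
      by_contra! h
      have h' := abs_lt.1 h
      refine ht ?_
      simp only [q, ContinuousMap.sub_apply, ContinuousMap.coe_mk]
      rw [min_eq_right h'.2.le, max_eq_right h'.1.le, sub_self]
    · rw [Function.update_of_ne hab.symm] at ht
      have h1 := congrArg (fun f : C(K, ℝ) => f t) hv
      simp only [ContinuousMap.mul_apply, ContinuousMap.zero_apply] at h1
      have h2 := (mul_eq_zero.1 h1).resolve_right ht
      simp [y, h2]
  have h1 : L (v a) = L q := by rwa [map_sub, sub_eq_zero] at h0
  have hq : ‖q‖ ≤ ε := (ContinuousMap.norm_le _ hε.le).2 fun t => by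
    rw [Real.norm_eq_abs, abs_le]
    exact ⟨le_max_left _ _, max_le (by linarith) (min_le_left _ _)⟩
  rw [h1]
  exact (L.le_opNorm q).trans (mul_le_mul_of_nonneg_left hq (norm_nonneg _))

/-- With the other slots frozen this is a bilinear form in slots a and b, so
`bilinear_eq_apply_mul_one` applies. -/
theorem symmSum_update_update (hA : IsOrthogonallyAdditive fun x => A fun _ => x)
    (v : ι → C(K, ℝ)) {a b : ι} (hab : a ≠ b) :
    A.symmSum v = A.symmSum (Function.update (Function.update v a (v a * v b)) b 1) := by
  let C : C(K, ℝ) →ₗ[ℝ] C(K, ℝ) →ₗ[ℝ] ℝ := LinearMap.mk₂ ℝ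
    (fun f g => A.symmSum (Function.update (Function.update v a f) b g))
    (fun f f' g => by
      simp only [Function.update_comm hab]; exact A.symmSum.map_update_add _ _ _ _)
    (fun c f g => by
      simp only [Function.update_comm hab]; exact A.symmSum.map_update_smul _ _ _ _)
    (fun f g g' => A.symmSum.map_update_add _ _ _ _)
    (fun c f g => A.symmSum.map_update_smul _ _ _ _)
  have hC : ∀ f g, C f g = A.symmSum (Function.update (Function.update v a f) b g) :=
    fun _ _ => rfl
  have h := bilinear_eq_apply_mul_one C
    (c := ‖A.symmSum‖ * ∏ i ∈ (Finset.univ.erase a).erase b, ‖v i‖) (by positivity)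
    (fun f g => by
      rw [hC]
      refine (A.symmSum.le_opNorm _).trans (le_of_eq ?_)
      rw [← Finset.mul_prod_erase _ _ (Finset.mem_univ a),
        ← Finset.mul_prod_erase _ _ (Finset.mem_erase.2 ⟨hab.symm, Finset.mem_univ b⟩)]
      rw [Function.update_of_ne hab, Function.update_self, Function.update_self,
        Finset.prod_congr rfl (g := fun i => ‖v i‖)]
      · ring
      · intro i hi
        simp only [Finset.mem_erase] at hi
        rw [Function.update_of_ne hi.1, Function.update_of_ne hi.2.1])
    (fun f g hfg => symmSum_eq_zero_of_mul_eq_zero A hA _ hab (by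
      rw [Function.update_of_ne hab, Function.update_self, Function.update_self, hfg]))
    (v a) (v b)
  rw [hC, hC] at h
  simpa using h

/-- Slot a absorbs the other slots one at a time, leaving 1 behind in each. -/
theorem symmSum_diag_eq (hA : IsOrthogonallyAdditive fun x => A fun _ => x) (a : ι)
    (x : C(K, ℝ)) : A.symmSum (fun _ => x) =
      A.symmSum (Function.update (fun _ => 1) a (x ^ Fintype.card ι)) := by
  have key : ∀ s : Finset ι, a ∉ s → A.symmSum (fun _ => x) =
      A.symmSum (fun k => if k = a then x ^ (s.card + 1) else if k ∈ s then 1 else x) := by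
    intro s
    induction s using Finset.induction_on with
    | empty => intro _; simp
    | insert b s hb ih =>
      intro ha
      rw [Finset.mem_insert, not_or] at ha
      rw [ih ha.2, symmSum_update_update A hA _ ha.1]
      congr 1
      funext k
      rcases eq_or_ne k b with rfl | hkb
      · simp [Ne.symm ha.1]
      · rw [Function.update_of_ne hkb]
        rcases eq_or_ne k a with rfl | hka
        · simp [hb, Finset.card_insert_of_notMem hb, Ne.symm ha.1, pow_succ]
        · simp [hka, hkb]
  rw [key (Finset.univ.erase a) (Finset.notMem_erase _ _)]
  congr 1
  funext k
  have h1 : 0 < Fintype.card ι := Fintype.card_pos_iff.2 ⟨a⟩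
  rcases eq_or_ne k a with rfl | hka
  · simp [Finset.card_erase_of_mem, Finset.card_univ, Nat.sub_add_cancel h1]
  · simp [hka]

end Representation

/-! ### Polynomials as functionals, and the image of the unit ball -/

namespace OrthPoly

variable {K : Type*} [TopologicalSpace K] {n : ℕ}

theorem exists_pow_eq (hn : 0 < n) {f : C(K, ℝ)} (hf : 0 ≤ f) : ∃ x : C(K, ℝ), 0 ≤ x ∧ x ^ n = f :=
  ⟨⟨fun t => f t ^ ((n : ℝ)⁻¹), f.continuous.rpow_const fun _ => Or.inr (by positivity)⟩,
    fun t => Real.rpow_nonneg (hf t) _,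
    by ext t; exact Real.rpow_inv_natCast_pow (hf t) hn.ne'⟩

variable [CompactSpace K]

/-- The orthogonally additive polynomial `x ↦ φ (x ^ n)` given by a bounded functional `φ`. -/
noncomputable def ofFunctional (hn : 0 < n) : (C(K, ℝ) →L[ℝ] ℝ) →ₗ[ℝ] OrthPoly n C(K, ℝ) where
  toFun φ := ⟨fun x => φ (x ^ n),
    ⟨φ.compContinuousMultilinearMap (ContinuousMultilinearMap.mkPiAlgebraFin ℝ n C(K, ℝ)),
      fun x => by simp⟩,
    fun x y h => by
      change φ ((x + y) ^ n) = φ (x ^ n) + φ (y ^ n)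
      rw [← map_add]
      refine congrArg φ (ContinuousMap.ext fun t => ?_)
      have h' : |x t| ⊓ |y t| = 0 := by
        simpa using congrArg (fun f : C(K, ℝ) => f t) h
      rcases min_choice |x t| |y t| with hm | hm
      · simp [abs_eq_zero.1 (hm.symm.trans h'), hn.ne']
      · simp [abs_eq_zero.1 (hm.symm.trans h'), hn.ne']⟩
  map_add' _ _ := rfl
  map_smul' _ _ := rfl

theorem ofFunctional_apply (hn : 0 < n) (φ : C(K, ℝ) →L[ℝ] ℝ) (x : C(K, ℝ)) :
    ofFunctional hn φ x = φ (x ^ n) := rfl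

/-- Every orthogonally additive `n`-homogeneous polynomial on `C(K)` is of the form
`x ↦ φ (x ^ n)`. -/
theorem ofFunctional_surjective (hn : 0 < n) :
    Function.Surjective (ofFunctional (K := K) hn) := by
  intro P
  obtain ⟨A, hA⟩ := P.2.1
  have hA' : IsOrthogonallyAdditive fun x => A fun _ => x := fun x y h => by
    simpa only [← hA] using P.2.2 x y h
  -- The factor n! counts the permutations in the unnormalized symmetrization.
  refine ⟨(n.factorial : ℝ)⁻¹ • A.symmSum.toContinuousLinearMap (fun _ => 1) ⟨0, hn⟩,
    ext fun x => ?_⟩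
  have h := symmSum_diag_eq A hA' ⟨0, hn⟩ x
  rw [A.symmSum_diag, Fintype.card_fin, ← hA] at h
  have h2 : (n.factorial : ℝ) ≠ 0 := by positivity
  rw [ofFunctional_apply]
  change (n.factorial : ℝ)⁻¹ * A.symmSum (Function.update (fun _ => 1) ⟨0, hn⟩ (x ^ n)) = P.1 x
  rw [← h, inv_mul_cancel_left₀ h2]

/-- Even when n is even, the n-th powers include all nonnegative functions, and these span C(K). -/
theorem ofFunctional_injective (hn : 0 < n) :
    Function.Injective (ofFunctional (K := K) hn) := by
  intro φ ψ h
  have key : ∀ f : C(K, ℝ), 0 ≤ f → φ f = ψ f := by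
    intro f hf
    obtain ⟨x, -, rfl⟩ := exists_pow_eq hn hf
    rw [← ofFunctional_apply hn, h, ofFunctional_apply]
  ext f
  rw [← posPart_sub_negPart f, map_sub, map_sub, key _ (posPart_nonneg f),
    key _ (negPart_nonneg f)]

/-- The representation of orthogonally additive polynomials on `C(K)` by bounded functionals. -/
noncomputable def functionalEquiv (hn : 0 < n) :
    (C(K, ℝ) →L[ℝ] ℝ) ≃ₗ[ℝ] OrthPoly n C(K, ℝ) :=
  LinearEquiv.ofBijective (ofFunctional hn)
    ⟨ofFunctional_injective hn, ofFunctional_surjective hn⟩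

theorem functionalEquiv_apply (hn : 0 < n) (φ : C(K, ℝ) →L[ℝ] ℝ) (x : C(K, ℝ)) :
    functionalEquiv hn φ x = φ (x ^ n) := rfl

theorem functionalEquiv_evalCLM (hn : 0 < n) (t : K) :
    functionalEquiv hn (ContinuousMap.evalCLM ℝ t) = deltaPow hn t :=
  ext fun _ => rfl

theorem mem_closedBall_iff (P : OrthPoly n C(K, ℝ)) :
    P ∈ Metric.closedBall (0 : OrthPoly n C(K, ℝ)) 1 ↔ ∀ x : C(K, ℝ), ‖x‖ ≤ 1 → |P x| ≤ 1 := by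
  rw [mem_closedBall_zero_iff]
  exact ⟨fun h x hx => (P.abs_apply_le_norm hx).trans h, norm_le⟩

/-- For odd n every f in the unit ball is an n-th power from the unit ball: the root of f⁺ minus the
root of f⁻. -/
theorem functionalEquiv_mem_closedBall_iff_of_odd (hn : 0 < n) (h : Odd n)
    (φ : C(K, ℝ) →L[ℝ] ℝ) :
    functionalEquiv hn φ ∈ Metric.closedBall (0 : OrthPoly n C(K, ℝ)) 1 ↔
      ∀ f : C(K, ℝ), ‖f‖ ≤ 1 → |φ f| ≤ 1 := by
  rw [mem_closedBall_iff]
  constructor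
  · intro hφ f hf
    obtain ⟨x, hx0, hx⟩ := exists_pow_eq hn (posPart_nonneg f)
    obtain ⟨z, hz0, hz⟩ := exists_pow_eq hn (negPart_nonneg f)
    have hxz : ∀ t, (x - z) t ^ n = f t ∧ |(x - z) t| ^ n = |f t| := by
      intro t
      have h1 : x t ^ n = (f t)⁺ := congrArg (fun g : C(K, ℝ) => g t) hx
      have h2 : z t ^ n = (f t)⁻ := congrArg (fun g : C(K, ℝ) => g t) hz
      rw [← abs_pow, and_iff_left_of_imp (fun h => by rw [h]), ContinuousMap.sub_apply]
      rcases le_total 0 (f t) with h3 | h3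
      · rw [posPart_of_nonneg h3] at h1
        rw [negPart_of_nonneg h3] at h2
        rw [eq_zero_of_pow_eq_zero h2, sub_zero, h1]
      · rw [posPart_of_nonpos h3] at h1
        rw [negPart_of_nonpos h3] at h2
        rw [eq_zero_of_pow_eq_zero h1, zero_sub, h.neg_pow, h2, neg_neg]
    have h4 := hφ (x - z) ((ContinuousMap.norm_le _ zero_le_one).2 fun t => by
      rw [Real.norm_eq_abs, ← pow_le_one_iff_of_nonneg (abs_nonneg _) hn.ne', (hxz t).2]
      exact (f.norm_coe_le_norm t).trans hf)
    rwa [functionalEquiv_apply, show (x - z) ^ n = f by ext t; exact (hxz t).1] at h4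
  · intro hφ x hx
    exact hφ _ ((norm_pow_le' x hn).trans (pow_le_one₀ (norm_nonneg _) hx))

/-- For even n the n-th powers of the unit ball are exactly the functions in [0, 1]. -/
theorem functionalEquiv_mem_closedBall_iff_of_even (hn : 0 < n) (h : Even n)
    (φ : C(K, ℝ) →L[ℝ] ℝ) :
    functionalEquiv hn φ ∈ Metric.closedBall (0 : OrthPoly n C(K, ℝ)) 1 ↔
      ∀ f : C(K, ℝ), 0 ≤ f → f ≤ 1 → |φ f| ≤ 1 := by
  rw [mem_closedBall_iff]
  constructor
  · intro hφ f hf0 hf1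
    obtain ⟨x, hx0, rfl⟩ := exists_pow_eq hn hf0
    refine hφ x ((ContinuousMap.norm_le _ zero_le_one).2 fun t => ?_)
    have h0 : 0 ≤ x t := hx0 t
    rw [Real.norm_eq_abs, abs_of_nonneg h0, ← pow_le_one_iff_of_nonneg h0 hn.ne']
    exact hf1 t
  · intro hφ x hx
    refine hφ _ (fun t => ?_) (fun t => ?_)
    · exact h.pow_nonneg _
    · change x t ^ n ≤ 1
      rw [← h.pow_abs]
      exact pow_le_one₀ (abs_nonneg _) ((x.norm_coe_le_norm t).trans hx)

end OrthPoly

/-! ### Point evaluations and the dual ball -/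

section ExtremePoints

theorem eq_of_mem_extremePoints {E : Type*} [AddCommGroup E] [Module ℝ E] {S : Set E} {x y z : E}
    (hx : x ∈ Set.extremePoints ℝ S) (hy : y ∈ S) (hz : z ∈ S) {c : ℝ} (h0 : 0 < c) (h1 : c < 1)
    (h : c • y + (1 - c) • z = x) : y = x ∧ z = x :=
  (mem_extremePoints.1 hx).2 y hy z hz ⟨c, 1 - c, h0, sub_pos.2 h1, by ring, h⟩

theorem neg_mem_extremePoints {E : Type*} [AddCommGroup E] [Module ℝ E] {S : Set E}
    (hS : ∀ x ∈ S, -x ∈ S) {x : E} (hx : x ∈ Set.extremePoints ℝ S) :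
    -x ∈ Set.extremePoints ℝ S := by
  refine mem_extremePoints_iff_left.2 ⟨hS _ hx.1, ?_⟩
  rintro y hy z hz ⟨a, b, ha, hb, hab, h⟩
  have h1 : -y = x := (mem_extremePoints_iff_left.1 hx).2 _ (hS y hy) _ (hS z hz)
    ⟨a, b, ha, hb, hab, by rw [smul_neg, smul_neg, ← neg_add, h, neg_neg]⟩
  rw [← h1, neg_neg]

variable {K : Type*} [TopologicalSpace K]

/-- The evaluation functional `f ↦ f t` on `C(K)`. -/
noncomputable abbrev evalFunctional (t : K) : C(K, ℝ) →L[ℝ] ℝ := ContinuousMap.evalCLM ℝ t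

theorem eq_one_of_eval_eq_smul_eval {t : K} {a : ℝ}
    (h : evalFunctional t = a • evalFunctional t) : a = 1 := by
  have := congrArg (fun φ : C(K, ℝ) →L[ℝ] ℝ => φ 1) h
  simpa using this.symm

/-- The weight (1 + a)/2 exhibits aδ_t as a mixture of δ_t and -δ_t. The case a = 0 shows that 0 is
not extreme. -/
theorem abs_eq_one_of_smul_eval_mem_extremePoints {S : Set (C(K, ℝ) →L[ℝ] ℝ)} {t : K} {a : ℝ}
    (h1 : evalFunctional t ∈ S) (h2 : -evalFunctional t ∈ S) (ha : |a| ≤ 1)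
    (h : a • evalFunctional t ∈ Set.extremePoints ℝ S) : a = 1 ∨ a = -1 := by
  by_contra! hne
  obtain ⟨ha1, ha2⟩ := abs_le.1 ha
  have hlt : a < 1 := lt_of_le_of_ne ha2 hne.1
  have hgt : -1 < a := lt_of_le_of_ne ha1 hne.2.symm
  refine hne.1 (eq_one_of_eval_eq_smul_eval (eq_of_mem_extremePoints h h1 h2 (c := (1 + a) / 2)
    (by linarith) (by linarith) ?_).1)
  module

variable [CompactSpace K]

theorem norm_le_of_forall_abs_le {φ : C(K, ℝ) →L[ℝ] ℝ} {C : ℝ}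
    (h : ∀ f : C(K, ℝ), ‖f‖ ≤ 1 → |φ f| ≤ C) : ‖φ‖ ≤ C :=
  ContinuousLinearMap.opNorm_le_of_unit_norm ((abs_nonneg _).trans (h 0 (by simp)))
    fun f hf => h f hf.le

/-- The functional `f ↦ φ (h * f)`. -/
noncomputable def mulFunctional (h : C(K, ℝ)) (φ : C(K, ℝ) →L[ℝ] ℝ) : C(K, ℝ) →L[ℝ] ℝ :=
  φ.comp (ContinuousLinearMap.mul ℝ C(K, ℝ) h)

/-- A functional on `C(K)` all of whose multiples by functions with values in `[0, 1]` are
proportional to it is a multiple of a point evaluation. -/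
theorem exists_eq_smul_eval [T2Space K] {φ : C(K, ℝ) →L[ℝ] ℝ} (h0 : φ ≠ 0)
    (hφ : ∀ h : C(K, ℝ), 0 ≤ h → h ≤ 1 → ∃ c : ℝ, ∀ f, φ (h * f) = c * φ f) :
    ∃ t : K, φ = φ 1 • evalFunctional t := by
  have h1 : ∀ h : C(K, ℝ), ∃ c : ℝ, ∀ f, φ (h * f) = c * φ f := by
    intro h
    obtain ⟨M, hM, hM0⟩ : ∃ M : ℝ, ‖h‖ ≤ M ∧ 0 < M := ⟨‖h‖ + 1, by linarith, by positivity⟩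
    have hb : ∀ t, -M ≤ h t ∧ h t ≤ M := fun t =>
      abs_le.1 ((h.norm_coe_le_norm t).trans hM)
    obtain ⟨c, hc⟩ := hφ ((2 * M)⁻¹ • (h + M • 1))
      (fun t => by
        have := (hb t).1
        change 0 ≤ (2 * M)⁻¹ * (h t + M * 1)
        exact mul_nonneg (by positivity) (by linarith))
      (fun t => by
        have := (hb t).2
        change (2 * M)⁻¹ * (h t + M * 1) ≤ 1
        rw [inv_mul_le_iff₀ (by positivity)]
        linarith)
    refine ⟨2 * M * c - M, fun f => ?_⟩
    have h2 := hc f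
    rw [smul_mul_assoc, add_mul, smul_mul_assoc, one_mul, map_smul, map_add, map_smul, smul_eq_mul,
      smul_eq_mul, inv_mul_eq_iff_eq_mul₀ (by positivity)] at h2
    linarith
  have hone : φ 1 ≠ 0 := by
    intro h2
    refine h0 (ContinuousLinearMap.ext fun f => ?_)
    obtain ⟨c, hc⟩ := h1 f
    rw [← mul_one f, hc, h2, mul_zero, zero_apply]
  -- Evaluating the proportionality at 1 identifies the constant, so φ / φ 1 is multiplicative: a
  -- character of C(K).
  have hmul : ∀ f g, φ (f * g) = (φ 1)⁻¹ * φ f * φ g := by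
    intro f g
    obtain ⟨c, hc⟩ := h1 f
    have h2 := hc 1
    rw [mul_one] at h2
    rw [hc g, h2]
    field_simp
  let χ : C(K, ℝ) →ₐ[ℝ] ℝ := AlgHom.ofLinearMap ((φ 1)⁻¹ • (φ : C(K, ℝ) →ₗ[ℝ] ℝ))
    (by simp [hone])
    (fun f g => by
      simp only [LinearMap.smul_apply, ContinuousLinearMap.coe_coe, hmul, smul_eq_mul]
      ring)
  obtain ⟨t, ht⟩ := (WeakDual.CharacterSpace.continuousMapEval_bijective K ℝ).2
    (WeakDual.CharacterSpace.equivAlgHom.symm χ)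
  refine ⟨t, ContinuousLinearMap.ext fun f => ?_⟩
  have h2 : f t = (φ 1)⁻¹ * φ f :=
    congrArg (fun ψ : WeakDual.characterSpace ℝ C(K, ℝ) => ψ f) ht
  change φ f = φ 1 * f t
  rw [h2, mul_inv_cancel_left₀ hone]

/-- The closed unit ball of the dual of `C(K)`. -/
def dualBall (K : Type*) [TopologicalSpace K] [CompactSpace K] : Set (C(K, ℝ) →L[ℝ] ℝ) :=
  {φ | ∀ f : C(K, ℝ), ‖f‖ ≤ 1 → |φ f| ≤ 1}

/-- The absolute polar of the order interval `[0, 1]` of `C(K)`. -/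
def intervalPolar (K : Type*) [TopologicalSpace K] [CompactSpace K] : Set (C(K, ℝ) →L[ℝ] ℝ) :=
  {φ | ∀ f : C(K, ℝ), 0 ≤ f → f ≤ 1 → |φ f| ≤ 1}

theorem neg_mem_dualBall : ∀ φ ∈ dualBall K, -φ ∈ dualBall K := fun φ hφ f hf => by
  rw [neg_apply, abs_neg]; exact hφ f hf

theorem neg_mem_intervalPolar : ∀ φ ∈ intervalPolar K, -φ ∈ intervalPolar K :=
  fun φ hφ f hf hf' => by
    rw [neg_apply, abs_neg]; exact hφ f hf hf'

theorem dualBall_subset_intervalPolar : dualBall K ⊆ intervalPolar K := fun φ hφ f hf0 hf1 =>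
  hφ f ((ContinuousMap.norm_le _ zero_le_one).2 fun t => by
    rw [Real.norm_eq_abs, abs_of_nonneg (show 0 ≤ f t from hf0 t)]; exact hf1 t)

theorem eval_mem_dualBall (t : K) : evalFunctional t ∈ dualBall K := fun f hf =>
  (f.norm_coe_le_norm t).trans hf

theorem eq_zero_of_forall_mem_Icc {φ : C(K, ℝ) →L[ℝ] ℝ} {Z : Set K}
    (h : ∀ f : C(K, ℝ), 0 ≤ f → f ≤ 1 → (∀ t ∈ Z, f t = 0) → φ f = 0) (f : C(K, ℝ))
    (hf : ∀ t ∈ Z, f t = 0) : φ f = 0 := by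
  have key : ∀ g : C(K, ℝ), 0 ≤ g → (∀ t ∈ Z, g t = 0) → φ g = 0 := by
    intro g hg0 hg
    have hM : 0 < ‖g‖ + 1 := by positivity
    have h1 := h ((‖g‖ + 1)⁻¹ • g) (smul_nonneg (by positivity) hg0)
      (fun t => by
        change (‖g‖ + 1)⁻¹ * g t ≤ 1
        rw [inv_mul_le_iff₀ hM]
        linarith [(le_abs_self _).trans (g.norm_coe_le_norm t)])
      (fun t ht => by simp [hg t ht])
    rw [map_smul, smul_eq_mul] at h1
    exact (mul_eq_zero.1 h1).resolve_left (by positivity)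
  have e : ∀ t, f⁺ t = (f t)⁺ ∧ f⁻ t = (f t)⁻ := fun _ => ⟨rfl, rfl⟩
  rw [← posPart_sub_negPart f, map_sub, key _ (posPart_nonneg f) fun t ht => by simp [e, hf t ht],
    key _ (negPart_nonneg f) fun t ht => by simp [e, hf t ht], sub_zero]

/-- Both components must take the maximal value 1 at the unit. Testing 1 - f then makes them
nonnegative on [0, 1], so they vanish where their mixture does and annihilate the kernel of δ_t. -/
theorem eval_mem_extremePoints_intervalPolar (t : K) :
    evalFunctional t ∈ Set.extremePoints ℝ (intervalPolar K) := by
  refine mem_extremePoints_iff_left.2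
    ⟨dualBall_subset_intervalPolar (eval_mem_dualBall t), ?_⟩
  rintro φ hφ ψ hψ ⟨a, b, ha, hb, hab, h⟩
  have heval : ∀ f : C(K, ℝ), a * φ f + b * ψ f = f t := fun f =>
    congrArg (fun θ : C(K, ℝ) →L[ℝ] ℝ => θ f) h
  have hle : ∀ f : C(K, ℝ), 0 ≤ f → f ≤ 1 → φ f ≤ 1 ∧ ψ f ≤ 1 := fun f h0 h1 =>
    ⟨(abs_le.1 (hφ f h0 h1)).2, (abs_le.1 (hψ f h0 h1)).2⟩
  have hone : φ 1 = 1 ∧ ψ 1 = 1 := by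
    have h1 := hle 1 zero_le_one le_rfl
    have h2 : a * φ 1 + b * ψ 1 = 1 := heval 1
    constructor <;> nlinarith
  have hzero : ∀ f : C(K, ℝ), 0 ≤ f → f ≤ 1 → f t = 0 → φ f = 0 := by
    intro f h0 h1 hf
    have h2 := hle (1 - f) (sub_nonneg.2 h1) (sub_le_self _ h0)
    rw [map_sub, map_sub, hone.1, hone.2] at h2
    have h3 := heval f
    rw [hf] at h3
    nlinarith
  refine ContinuousLinearMap.ext fun f => ?_
  have h2 := eq_zero_of_forall_mem_Icc (Z := {t}) (fun g h0 h1 hg => hzero g h0 h1 (hg t rfl))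
    (f - f t • 1) (by rintro _ rfl; simp)
  rw [map_sub, map_smul, hone.1, smul_eq_mul, mul_one, sub_eq_zero] at h2
  exact h2

theorem eval_sub_eval_mem_extremePoints_intervalPolar [T2Space K] {s t : K} (hst : s ≠ t) :
    evalFunctional s - evalFunctional t ∈ Set.extremePoints ℝ (intervalPolar K) := by
  refine mem_extremePoints_iff_left.2 ⟨fun f h0 h1 => ?_, ?_⟩
  · have hs : 0 ≤ f s ∧ f s ≤ 1 := ⟨h0 s, h1 s⟩
    have ht : 0 ≤ f t ∧ f t ≤ 1 := ⟨h0 t, h1 t⟩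
    change |f s - f t| ≤ 1
    rw [abs_le]
    constructor <;> linarith
  rintro φ hφ ψ hψ ⟨a, b, ha, hb, hab, h⟩
  have heval : ∀ f : C(K, ℝ), a * φ f + b * ψ f = f s - f t := fun f =>
    congrArg (fun θ : C(K, ℝ) →L[ℝ] ℝ => θ f) h
  have hpos : ∀ f : C(K, ℝ), 0 ≤ f → f ≤ 1 → f s = 1 → f t = 0 → φ f = 1 := by
    intro f h0 h1 hs ht
    have h2 := abs_le.1 (hφ f h0 h1)
    have h3 := abs_le.1 (hψ f h0 h1)
    have h4 := heval f
    rw [hs, ht] at h4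
    nlinarith
  have hneg : ∀ f : C(K, ℝ), 0 ≤ f → f ≤ 1 → f s = 0 → f t = 1 → φ f = -1 := by
    intro f h0 h1 hs ht
    have h2 := abs_le.1 (hφ f h0 h1)
    have h3 := abs_le.1 (hψ f h0 h1)
    have h4 := heval f
    rw [hs, ht] at h4
    nlinarith
  -- The components are forced to ±1 on functions in [0, 1] taking the values 0 and 1 at s and t; a
  -- Urysohn function u and 1 - u are such.
  obtain ⟨u, hut, hus, hu⟩ := exists_continuous_zero_one_of_isClosed
    (isClosed_singleton (x := t)) (isClosed_singleton (x := s))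
    (Set.disjoint_singleton.2 hst.symm)
  replace hut : u t = 0 := hut rfl
  replace hus : u s = 1 := hus rfl
  have hu0 : 0 ≤ u := fun x => (hu x).1
  have hu1 : u ≤ 1 := fun x => (hu x).2
  have h1u : 0 ≤ 1 - u := sub_nonneg.2 hu1
  have hφu : φ u = 1 := hpos u hu0 hu1 hus hut
  have hφu' : φ (1 - u) = -1 :=
    hneg _ h1u (sub_le_self _ hu0) (by simp [hus]) (by simp [hut])
  have hzero : ∀ f : C(K, ℝ), 0 ≤ f → f ≤ 1 → f s = 0 → f t = 0 → φ f = 0 := by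
    intro f h0 h1 hs ht
    have h1f : 0 ≤ 1 - f := sub_nonneg.2 h1
    have h2 := hpos (u * (1 - f)) (mul_nonneg hu0 h1f)
      (mul_le_one₀ hu1 h1f (sub_le_self _ h0)) (by simp [hus, hs]) (by simp [hut])
    have h3 := hneg ((1 - u) * (1 - f)) (mul_nonneg h1u h1f)
      (mul_le_one₀ (sub_le_self _ hu0) h1f (sub_le_self _ h0)) (by simp [hus]) (by simp [hut, ht])
    -- If f vanishes at s and t, all four terms are of the forced kind, and their values 1, -1, 1,
    -- -1 cancel.
    have h4 : f = u + (1 - u) - u * (1 - f) - (1 - u) * (1 - f) := by ring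
    rw [h4, map_sub, map_sub, map_add, hφu, hφu', h2, h3]
    ring
  refine ContinuousLinearMap.ext fun f => ?_
  have h2 := eq_zero_of_forall_mem_Icc (Z := {s, t})
    (fun g h0 h1 hg => hzero g h0 h1 (hg s (by simp)) (hg t (by simp)))
    (f - f s • u - f t • (1 - u)) (by
      rintro _ (rfl | rfl)
      · simp [hus]
      · simp [hut])
  rw [map_sub, map_sub, map_smul, map_smul, hφu, hφu', smul_eq_mul, smul_eq_mul] at h2
  change φ f = f s - f t
  linarith

/-- The multiple `h φ` and the complementary multiple of `φ` have norms adding up to at most `1`. -/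
theorem norm_mulFunctional_add_le {φ : C(K, ℝ) →L[ℝ] ℝ} (hφ : φ ∈ dualBall K) {h : C(K, ℝ)}
    (h0 : 0 ≤ h) (h1 : h ≤ 1) : ‖mulFunctional h φ‖ + ‖mulFunctional (1 - h) φ‖ ≤ 1 := by
  have key : ∀ f g : C(K, ℝ), ‖f‖ ≤ 1 → ‖g‖ ≤ 1 → φ (h * f) + φ ((1 - h) * g) ≤ 1 := by
    intro f g hf hg
    rw [← map_add]
    refine (abs_le.1 (hφ _ ((ContinuousMap.norm_le _ zero_le_one).2 fun t => ?_))).2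
    have ht0 : 0 ≤ h t := h0 t
    have ht1 : h t ≤ 1 := h1 t
    have hft := abs_le.1 ((f.norm_coe_le_norm t).trans hf)
    have hgt := abs_le.1 ((g.norm_coe_le_norm t).trans hg)
    change |h t * f t + (1 - h t) * g t| ≤ 1
    rw [abs_le]
    constructor <;> nlinarith
  have key2 : ∀ f g : C(K, ℝ), ‖f‖ ≤ 1 → ‖g‖ ≤ 1 → |φ (h * f)| + |φ ((1 - h) * g)| ≤ 1 := by
    intro f g hf hg
    have e1 := key f g hf hg
    have e2 := key (-f) g (by simpa) hg
    have e3 := key f (-g) hf (by simpa)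
    have e4 := key (-f) (-g) (by simpa) (by simpa)
    simp only [mul_neg, map_neg] at e2 e3 e4
    rcases abs_cases (φ (h * f)) with ⟨h5, -⟩ | ⟨h5, -⟩ <;>
    rcases abs_cases (φ ((1 - h) * g)) with ⟨h6, -⟩ | ⟨h6, -⟩ <;> rw [h5, h6] <;> linarith
  rw [← le_sub_iff_add_le]
  refine norm_le_of_forall_abs_le fun f hf => ?_
  rw [le_sub_comm]
  refine norm_le_of_forall_abs_le fun g hg => ?_
  rw [le_sub_iff_add_le']
  exact key2 f g hf hg

theorem mem_extremePoints_dualBall_iff [T2Space K] [Nonempty K] {φ : C(K, ℝ) →L[ℝ] ℝ} :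
    φ ∈ Set.extremePoints ℝ (dualBall K) ↔
      ∃ t : K, φ = evalFunctional t ∨ φ = -evalFunctional t := by
  constructor
  · intro hφ
    have h0 : φ ≠ 0 := by
      rintro rfl
      obtain ⟨t⟩ := ‹Nonempty K›
      have := abs_eq_one_of_smul_eval_mem_extremePoints (a := 0) (eval_mem_dualBall t)
        (neg_mem_dualBall _ (eval_mem_dualBall t))
        (by simp) (by rwa [zero_smul])
      norm_num at this
    obtain ⟨t, ht⟩ := exists_eq_smul_eval h0 fun h hh0 hh1 => by
      have hN := norm_mulFunctional_add_le hφ.1 hh0 hh1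
      have hsub : ∀ f, φ ((1 - h) * f) = φ f - φ (h * f) := fun f => by
        rw [sub_mul, one_mul, map_sub]
      have hvanish : ∀ k : C(K, ℝ), ‖mulFunctional k φ‖ = 0 → ∀ f, φ (k * f) = 0 := by
        intro k hk f
        have h2 := (mulFunctional k φ).le_opNorm f
        rw [hk, zero_mul] at h2
        exact norm_le_zero_iff.1 h2
      rcases (norm_nonneg (mulFunctional h φ)).eq_or_lt' with hz | hpos
      · exact ⟨0, fun f => by rw [hvanish h hz, zero_mul]⟩
      rcases (norm_nonneg (mulFunctional (1 - h) φ)).eq_or_lt' with hz | hpos'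
      · refine ⟨1, fun f => ?_⟩
        have h2 := hvanish _ hz f
        rw [hsub] at h2
        linarith
      set N := ‖mulFunctional h φ‖ with hNdef
      have hscale : ∀ (ψ : C(K, ℝ) →L[ℝ] ℝ) (M : ℝ), ‖ψ‖ ≤ M → 0 < M → M⁻¹ • ψ ∈ dualBall K := by
        intro ψ M hM hM0 f hf
        rw [smul_apply, smul_eq_mul, abs_mul, abs_of_pos (inv_pos.2 hM0),
          inv_mul_le_iff₀ hM0, mul_one]
        exact (ψ.le_opNorm f).trans ((mul_le_of_le_one_right (norm_nonneg _) hf).trans hM)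
      -- The second piece is scaled by 1 - N, which only bounds its norm from above; this suffices
      -- for membership in the ball.
      have h2 := (eq_of_mem_extremePoints hφ (hscale _ N le_rfl hpos)
        (hscale (mulFunctional (1 - h) φ) (1 - N) (by linarith) (by linarith)) hpos
        (by linarith) (by
          rw [smul_inv_smul₀ hpos.ne', smul_inv_smul₀ (by linarith)]
          ext f
          change φ (h * f) + φ ((1 - h) * f) = φ f
          rw [hsub]; ring)).1
      refine ⟨N, fun f => ?_⟩
      have h3 : N⁻¹ * φ (h * f) = φ f := congrArg (fun θ : C(K, ℝ) →L[ℝ] ℝ => θ f) h2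
      rw [← h3, mul_inv_cancel_left₀ hpos.ne']
    have h1 := abs_eq_one_of_smul_eval_mem_extremePoints (a := φ 1) (eval_mem_dualBall t)
      (neg_mem_dualBall _ (eval_mem_dualBall t))
      (hφ.1 1 ((ContinuousMap.norm_le _ zero_le_one).2 fun t => by simp))
      (by rwa [← ht])
    refine ⟨t, h1.imp (fun h => ?_) (fun h => ?_)⟩
    · rw [ht, h, one_smul]
    · rw [ht, h]; module
  -- Extremality in the larger set `intervalPolar K` passes to the subset.
  · have h1 : ∀ t : K, evalFunctional t ∈ Set.extremePoints ℝ (dualBall K) := fun t =>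
      inter_extremePoints_subset_extremePoints_of_subset dualBall_subset_intervalPolar
        ⟨eval_mem_dualBall t, eval_mem_extremePoints_intervalPolar t⟩
    rintro ⟨t, rfl | rfl⟩
    · exact h1 t
    · exact neg_mem_extremePoints neg_mem_dualBall (h1 t)

end ExtremePoints

/-! ### Positive functionals and the polar of the order interval -/

section PositiveFunctionals

variable {K : Type*} [TopologicalSpace K]

/-- The sublinear functional `f ↦ sup {φ g : 0 ≤ g ≤ f⁺}`. -/
noncomputable def supIcc (φ : C(K, ℝ) →L[ℝ] ℝ) (f : C(K, ℝ)) : ℝ :=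
  sSup (φ '' Set.Icc 0 (f ⊔ 0))

theorem supIcc_le {φ : C(K, ℝ) →L[ℝ] ℝ} {f : C(K, ℝ)} {C : ℝ}
    (h : ∀ g, 0 ≤ g → g ≤ f ⊔ 0 → φ g ≤ C) : supIcc φ f ≤ C := by
  refine csSup_le ⟨φ 0, 0, ⟨le_rfl, le_sup_right⟩, rfl⟩ ?_
  rintro _ ⟨k, ⟨hk0, hk⟩, rfl⟩
  exact h k hk0 hk

variable [CompactSpace K]

theorem abs_apply_mul_le_of_nonneg (α : C(K, ℝ) →ₗ[ℝ] ℝ) (hα : ∀ f : C(K, ℝ), 0 ≤ f → 0 ≤ α f)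
    {h : C(K, ℝ)} (hh : 0 ≤ h) (f : C(K, ℝ)) : |α (h * f)| ≤ ‖f‖ * α h := by
  have hf : ∀ t, -‖f‖ ≤ f t ∧ f t ≤ ‖f‖ := fun t => abs_le.1 (f.norm_coe_le_norm t)
  have h1 := hα (‖f‖ • h - h * f) (fun t => by
    change 0 ≤ ‖f‖ * h t - h t * f t
    have : 0 ≤ h t := hh t
    nlinarith [hf t])
  have h2 := hα (‖f‖ • h + h * f) (fun t => by
    change 0 ≤ ‖f‖ * h t + h t * f t
    have : 0 ≤ h t := hh t
    nlinarith [hf t])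
  rw [map_sub, map_smul, smul_eq_mul] at h1
  rw [map_add, map_smul, smul_eq_mul] at h2
  rw [abs_le]
  constructor <;> linarith

theorem le_supIcc (φ : C(K, ℝ) →L[ℝ] ℝ) {f g : C(K, ℝ)} (h0 : 0 ≤ g) (h : g ≤ f ⊔ 0) :
    φ g ≤ supIcc φ f := by
  refine le_csSup ⟨‖φ‖ * ‖f ⊔ 0‖, ?_⟩ ⟨g, ⟨h0, h⟩, rfl⟩
  rintro _ ⟨k, ⟨hk0, hk⟩, rfl⟩
  refine (le_abs_self _).trans ((φ.le_opNorm k).trans (mul_le_mul_of_nonneg_left ?_ (norm_nonneg _)))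
  refine (ContinuousMap.norm_le _ (norm_nonneg _)).2 fun t => ?_
  rw [Real.norm_eq_abs, abs_of_nonneg (show 0 ≤ k t from hk0 t)]
  exact (hk t).trans ((le_abs_self _).trans ((f ⊔ 0).norm_coe_le_norm t))

theorem supIcc_of_nonpos (φ : C(K, ℝ) →L[ℝ] ℝ) {f : C(K, ℝ)} (h : f ≤ 0) : supIcc φ f = 0 := by
  refine le_antisymm (supIcc_le fun g h0 h1 => ?_) ?_
  · rw [sup_eq_right.2 h] at h1
    rw [le_antisymm h1 h0, map_zero]
  · rw [← map_zero φ]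
    exact le_supIcc φ le_rfl le_sup_right

theorem supIcc_smul (φ : C(K, ℝ) →L[ℝ] ℝ) {c : ℝ} (hc : 0 < c) (f : C(K, ℝ)) :
    supIcc φ (c • f) = c * supIcc φ f := by
  have key : ∀ (c : ℝ) (f : C(K, ℝ)), 0 < c → supIcc φ (c • f) ≤ c * supIcc φ f := by
    intro c f hc
    refine supIcc_le fun g h0 h1 => ?_
    have h2 : φ (c⁻¹ • g) ≤ supIcc φ f := by
      refine le_supIcc φ (smul_nonneg (by positivity) h0) fun t => ?_
      change c⁻¹ * g t ≤ max (f t) 0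
      rw [inv_mul_le_iff₀ hc, mul_max_of_nonneg _ _ hc.le, mul_zero]
      exact h1 t
    rwa [map_smul, smul_eq_mul, inv_mul_le_iff₀ hc] at h2
  refine le_antisymm (key c f hc) ?_
  have h := key c⁻¹ (c • f) (inv_pos.2 hc)
  rwa [inv_smul_smul₀ hc.ne', le_inv_mul_iff₀ hc] at h

/-- Riesz decomposition: 0 ≤ k ≤ (f + g)⁺ splits as k ⊓ f⁺ plus a remainder between 0 and g⁺. -/
theorem supIcc_add_le (φ : C(K, ℝ) →L[ℝ] ℝ) (f g : C(K, ℝ)) :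
    supIcc φ (f + g) ≤ supIcc φ f + supIcc φ g := by
  refine supIcc_le fun k h0 h1 => ?_
  have e1 : φ (k ⊓ (f ⊔ 0)) ≤ supIcc φ f :=
    le_supIcc φ (le_inf h0 le_sup_right) inf_le_right
  have e2 : φ (k - k ⊓ (f ⊔ 0)) ≤ supIcc φ g := by
    refine le_supIcc φ (sub_nonneg.2 inf_le_left) fun t => ?_
    have h2 : k t ≤ max (f t + g t) 0 := h1 t
    change k t - min (k t) (max (f t) 0) ≤ max (g t) 0
    grind
  rw [map_sub] at e2
  linarith

/-- A functional bounded by `1` in absolute value on the order interval `[0, 1]` is a difference of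
positive functionals of mass at most `1`. -/
theorem exists_positive_decomposition [Nonempty K] {φ : C(K, ℝ) →L[ℝ] ℝ}
    (hφ : φ ∈ intervalPolar K) : ∃ α β : C(K, ℝ) →L[ℝ] ℝ,
      (∀ f : C(K, ℝ), 0 ≤ f → 0 ≤ α f) ∧ (∀ f : C(K, ℝ), 0 ≤ f → 0 ≤ β f) ∧
      α 1 ≤ 1 ∧ β 1 ≤ 1 ∧ φ = α - β := by
  have h10 : (1 : C(K, ℝ)) ⊔ 0 = 1 := sup_eq_left.2 zero_le_one
  have hN1 : 0 ≤ supIcc φ 1 := by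
    rw [← map_zero φ]; exact le_supIcc φ le_rfl le_sup_right
  -- Hahn–Banach gives α ≤ `supIcc φ` with equality at 1. Domination yields positivity, since
  -- `supIcc φ` is 0 on nonpositive functions; equality at 1 yields α ≥ φ on [0, 1].
  obtain ⟨α, hα1, hα⟩ := exists_extension_of_le_sublinear
    (LinearPMap.mkSpanSingleton (1 : C(K, ℝ)) (supIcc φ 1) one_ne_zero) (supIcc φ)
    (fun c hc f => supIcc_smul φ hc f) (supIcc_add_le φ) (by
      rintro ⟨x, hx⟩
      obtain ⟨c, rfl⟩ := Submodule.mem_span_singleton.1 hx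
      rw [LinearPMap.mkSpanSingleton'_apply, RingHom.id_apply, smul_eq_mul]
      rcases le_or_gt c 0 with hc | hc
      · refine (mul_nonpos_of_nonpos_of_nonneg hc hN1).trans (le_of_eq ?_)
        exact (supIcc_of_nonpos φ (smul_nonpos_of_nonpos_of_nonneg hc zero_le_one)).symm
      · exact (supIcc_smul φ hc 1).ge)
  have hαone : α 1 = supIcc φ 1 :=
    (hα1 ⟨1, Submodule.mem_span_singleton_self 1⟩).trans
      (LinearPMap.mkSpanSingleton_apply ℝ ℝ one_ne_zero _)
  have hαpos : ∀ f : C(K, ℝ), 0 ≤ f → 0 ≤ α f := by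
    intro f hf
    have h := hα (-f)
    rw [supIcc_of_nonpos φ (neg_nonpos.2 hf), map_neg] at h
    linarith
  have hle : ∀ f : C(K, ℝ), 0 ≤ f → f ≤ 1 → φ f ≤ α f := by
    intro f h0 h1
    have h2 : supIcc φ (1 - f) ≤ supIcc φ 1 - φ f := by
      refine supIcc_le fun g hg0 hg1 => ?_
      rw [sup_eq_left.2 (sub_nonneg.2 h1)] at hg1
      have h3 : φ (g + f) ≤ supIcc φ 1 :=
        le_supIcc φ (add_nonneg hg0 h0) (h10.symm ▸ le_sub_iff_add_le.1 hg1)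
      rw [map_add] at h3
      linarith
    have h3 := hα (1 - f)
    rw [map_sub, hαone] at h3
    linarith
  let α' : C(K, ℝ) →L[ℝ] ℝ := α.mkContinuous (α 1) fun f => by
    have := abs_apply_mul_le_of_nonneg α hαpos zero_le_one f
    rw [one_mul] at this
    rwa [Real.norm_eq_abs, mul_comm]
  have hα' : ∀ f, α' f = α f := fun _ => rfl
  refine ⟨α', α' - φ, hαpos, fun f hf => ?_, ?_, ?_, by abel⟩
  · have hM : 0 < ‖f‖ + 1 := by positivity
    have h := hle ((‖f‖ + 1)⁻¹ • f) (smul_nonneg (by positivity) hf) (fun t => by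
      change (‖f‖ + 1)⁻¹ * f t ≤ 1
      rw [inv_mul_le_iff₀ hM]
      linarith [(le_abs_self _).trans (f.norm_coe_le_norm t)])
    rw [map_smul, map_smul, smul_eq_mul, smul_eq_mul] at h
    exact sub_nonneg.2 (le_of_mul_le_mul_left h (by positivity))
  · rw [hα', hαone]
    refine supIcc_le fun g h0 h1 => ?_
    rw [h10] at h1
    exact (abs_le.1 (hφ g h0 h1)).2
  -- φ g - φ 1 = -φ (1 - g), and 1 - g again lies in [0, 1].
  · change α 1 - φ 1 ≤ 1
    rw [hαone, sub_le_iff_le_add]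
    refine supIcc_le fun g h0 h1 => ?_
    rw [h10] at h1
    have h2 := (abs_le.1 (hφ (1 - g) (sub_nonneg.2 h1) (sub_le_self _ h0))).1
    rw [map_sub] at h2
    linarith

/-- The positive functionals on `C(K)` of mass `a`. -/
def positiveOfMass (K : Type*) [TopologicalSpace K] [CompactSpace K] (a : ℝ) :
    Set (C(K, ℝ) →L[ℝ] ℝ) :=
  {α | (∀ f : C(K, ℝ), 0 ≤ f → 0 ≤ α f) ∧ α 1 = a}

/-- The splitting hα + (1 - h)α again, now with masses adding exactly to a, so the weights are α h /
a and its complement. -/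
theorem exists_eq_smul_eval_of_mem_extremePoints_positiveOfMass [T2Space K] [Nonempty K] {a : ℝ}
    {α : C(K, ℝ) →L[ℝ] ℝ} (hα : α ∈ Set.extremePoints ℝ (positiveOfMass K a)) :
    ∃ t : K, α = a • evalFunctional t := by
  obtain ⟨hpos, hone⟩ := hα.1
  have hbound : ∀ {h : C(K, ℝ)}, 0 ≤ h → ∀ f, |α (h * f)| ≤ ‖f‖ * α h := fun hh f =>
    abs_apply_mul_le_of_nonneg (α : C(K, ℝ) →ₗ[ℝ] ℝ) hpos hh f
  have hzero : ∀ {h : C(K, ℝ)}, 0 ≤ h → α h = 0 → ∀ f, α (h * f) = 0 := fun hh h0 f => by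
    have h1 := hbound hh f
    rw [h0, mul_zero] at h1
    exact abs_nonpos_iff.1 h1
  by_cases hα0 : α = 0
  · obtain ⟨t⟩ := ‹Nonempty K›
    refine ⟨t, ?_⟩
    rw [← hone, hα0]
    simp
  have ha : 0 < a := by
    refine lt_of_le_of_ne (hone ▸ hpos 1 zero_le_one) fun h => hα0 ?_
    ext f
    simpa using hzero zero_le_one (hone.trans h.symm) f
  rw [← hone]
  refine exists_eq_smul_eval hα0 fun h h0 h1 => ?_
  have h1' : 0 ≤ 1 - h := sub_nonneg.2 h1
  have hsub : ∀ f, α ((1 - h) * f) = α f - α (h * f) := fun f => by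
    rw [sub_mul, one_mul, map_sub]
  have hsub1 : α (1 - h) = a - α h := by rw [map_sub, hone]
  rcases (hpos h h0).eq_or_lt' with hm | hm
  · exact ⟨0, fun f => by rw [hzero h0 hm, zero_mul]⟩
  rcases (hpos _ h1').eq_or_lt' with hm' | hm'
  · refine ⟨1, fun f => ?_⟩
    have h2 := hzero h1' hm' f
    rw [hsub] at h2
    linarith
  have hscale : ∀ {k : C(K, ℝ)}, 0 ≤ k → 0 < α k →
      (α k / a)⁻¹ • mulFunctional k α ∈ positiveOfMass K a := by
    intro k hk hk'
    refine ⟨fun f hf => mul_nonneg (by positivity) (hpos _ (mul_nonneg hk hf)), ?_⟩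
    change (α k / a)⁻¹ * α (k * 1) = a
    rw [mul_one]
    field_simp
  have hc : 1 - α h / a = α (1 - h) / a := by
    rw [hsub1]
    field_simp
  have h2 := (eq_of_mem_extremePoints hα (hscale h0 hm) (hscale h1' hm') (c := α h / a)
    (by positivity) (by linarith [div_pos hm' ha]) (by
      rw [hc, smul_inv_smul₀ (by positivity), smul_inv_smul₀ (by positivity)]
      ext f
      change α (h * f) + α ((1 - h) * f) = α f
      rw [hsub]; ring)).1
  refine ⟨α h / a, fun f => ?_⟩
  have h3 : (α h / a)⁻¹ * α (h * f) = α f := congrArg (fun θ : C(K, ℝ) →L[ℝ] ℝ => θ f) h2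
  rw [← h3, mul_inv_cancel_left₀ (by positivity)]

theorem sub_mem_intervalPolar {α β : C(K, ℝ) →L[ℝ] ℝ} (hα : ∀ f : C(K, ℝ), 0 ≤ f → 0 ≤ α f)
    (hβ : ∀ f : C(K, ℝ), 0 ≤ f → 0 ≤ β f) (hα1 : α 1 ≤ 1) (hβ1 : β 1 ≤ 1) :
    α - β ∈ intervalPolar K := by
  intro f h0 h1
  have e1 := hα f h0
  have e2 := hβ f h0
  have e3 := hα _ (sub_nonneg.2 h1)
  have e4 := hβ _ (sub_nonneg.2 h1)
  rw [map_sub] at e3 e4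
  change |α f - β f| ≤ 1
  rw [abs_le]
  constructor <;> linarith

/-- Splitting α at fixed mass, with β held fixed, splits α - β inside the polar. -/
theorem mem_extremePoints_positiveOfMass {α β : C(K, ℝ) →L[ℝ] ℝ}
    (hα : ∀ f : C(K, ℝ), 0 ≤ f → 0 ≤ α f) (hβ : ∀ f : C(K, ℝ), 0 ≤ f → 0 ≤ β f)
    (hα1 : α 1 ≤ 1) (hβ1 : β 1 ≤ 1) (h : α - β ∈ Set.extremePoints ℝ (intervalPolar K)) :
    α ∈ Set.extremePoints ℝ (positiveOfMass K (α 1)) := by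
  refine mem_extremePoints_iff_left.2 ⟨⟨hα, rfl⟩, ?_⟩
  rintro ψ ⟨hψ, hψ1⟩ θ ⟨hθ, hθ1⟩ ⟨a, b, ha, hb, hab, rfl⟩
  refine sub_left_injective ((mem_extremePoints_iff_left.1 h).2 (ψ - β)
    (sub_mem_intervalPolar hψ hβ (hψ1.trans_le hα1) hβ1) (θ - β)
    (sub_mem_intervalPolar hθ hβ (hθ1.trans_le hα1) hβ1) ⟨a, b, ha, hb, hab, ?_⟩)
  obtain rfl : b = 1 - a := by linarith
  module

/-- aδ_s - β is the mixture of δ_s - β and -β with weights a and 1 - a. -/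
theorem mass_eq_zero_or_one_of_mem_extremePoints {s : K} {a : ℝ} {β : C(K, ℝ) →L[ℝ] ℝ}
    (ha0 : 0 ≤ a) (ha1 : a ≤ 1) (hβ : ∀ f : C(K, ℝ), 0 ≤ f → 0 ≤ β f) (hβ1 : β 1 ≤ 1)
    (h : a • evalFunctional s - β ∈ Set.extremePoints ℝ (intervalPolar K)) : a = 0 ∨ a = 1 := by
  by_contra! hne
  have h1 := eq_of_mem_extremePoints h (c := a)
    (sub_mem_intervalPolar (α := evalFunctional s) (fun f hf => hf s) hβ (by simp) hβ1)
    (sub_mem_intervalPolar (α := 0) (fun f hf => by simp) hβ (by simp) hβ1)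
    (lt_of_le_of_ne ha0 hne.1.symm) (lt_of_le_of_ne ha1 hne.2) (by module)
  exact hne.2 (eq_one_of_eval_eq_smul_eval (sub_left_injective h1.1))

theorem mem_extremePoints_intervalPolar_iff [T2Space K] [Nonempty K] {φ : C(K, ℝ) →L[ℝ] ℝ} :
    φ ∈ Set.extremePoints ℝ (intervalPolar K) ↔
      (∃ t : K, φ = evalFunctional t ∨ φ = -evalFunctional t) ∨
      (∃ s t : K, s ≠ t ∧ φ = evalFunctional s - evalFunctional t) := by
  constructor
  · intro hφ
    obtain ⟨α, β, hα, hβ, hα1, hβ1, rfl⟩ := exists_positive_decomposition hφ.1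
    have hφ' := neg_mem_extremePoints neg_mem_intervalPolar hφ
    rw [neg_sub] at hφ'
    obtain ⟨s, hs⟩ := exists_eq_smul_eval_of_mem_extremePoints_positiveOfMass
      (mem_extremePoints_positiveOfMass hα hβ hα1 hβ1 hφ)
    obtain ⟨t, ht⟩ := exists_eq_smul_eval_of_mem_extremePoints_positiveOfMass
      (mem_extremePoints_positiveOfMass hβ hα hβ1 hα1 hφ')
    have ha := mass_eq_zero_or_one_of_mem_extremePoints (s := s) (hα 1 zero_le_one) hα1 hβ hβ1
      (by rwa [← hs])
    have hb := mass_eq_zero_or_one_of_mem_extremePoints (s := t) (hβ 1 zero_le_one) hβ1 hα hα1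
      (by rwa [← ht])
    have hne : α - β ≠ 0 := by
      intro h0
      have h1 : evalFunctional s ∈ intervalPolar K :=
        dualBall_subset_intervalPolar (eval_mem_dualBall s)
      have := abs_eq_one_of_smul_eval_mem_extremePoints (a := 0) h1 (neg_mem_intervalPolar _ h1)
        (by simp) (by rwa [zero_smul, ← h0])
      norm_num at this
    -- The masses (0,0), (0,1), (1,0), (1,1) give 0, -δ_t, δ_s, δ_s - δ_t; the first, and s = t in
    -- the last, are excluded because 0 is not extreme.
    rcases ha with ha | ha <;> rcases hb with hb | hb <;>
      simp only [ha, hb, zero_smul, one_smul] at hs ht <;> subst hs <;> subst ht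
    · simp at hne
    · exact Or.inl ⟨t, Or.inr (zero_sub _)⟩
    · exact Or.inl ⟨s, Or.inl (sub_zero _)⟩
    · refine Or.inr ⟨s, t, ?_, rfl⟩
      rintro rfl
      simp at hne
  · rintro (⟨t, rfl | rfl⟩ | ⟨s, t, hst, rfl⟩)
    · exact eval_mem_extremePoints_intervalPolar t
    · exact neg_mem_extremePoints neg_mem_intervalPolar (eval_mem_extremePoints_intervalPolar t)
    · exact eval_sub_eval_mem_extremePoints_intervalPolar hst

end PositiveFunctionals

/-! ### Transfer to polynomials -/

theorem LinearEquiv.apply_mem_extremePoints_iff {E F : Type*} [AddCommGroup E] [Module ℝ E]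
    [AddCommGroup F] [Module ℝ F] (e : E ≃ₗ[ℝ] F) {S : Set E} {T : Set F}
    (h : ∀ x, e x ∈ T ↔ x ∈ S) (x : E) :
    e x ∈ Set.extremePoints ℝ T ↔ x ∈ Set.extremePoints ℝ S := by
  have hT : T = e '' S := by
    ext y
    rw [e.image_eq_preimage_symm, Set.mem_preimage, ← h, e.apply_symm_apply]
  rw [hT, ← image_extremePoints, e.injective.mem_set_image]

theorem mainTheorem3 {K : Type*} [TopologicalSpace K] [CompactSpace K] [T2Space K] [Nonempty K]
    {n : ℕ} (hn : 0 < n) :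
    (Odd n → ∀ P : OrthPoly n C(K, ℝ),
      P ∈ Set.extremePoints ℝ (Metric.closedBall (0 : OrthPoly n C(K, ℝ)) 1) ↔
        ∃ t : K, P = OrthPoly.deltaPow hn t ∨ P = -OrthPoly.deltaPow hn t) ∧
    (Even n → ∀ P : OrthPoly n C(K, ℝ),
      P ∈ Set.extremePoints ℝ (Metric.closedBall (0 : OrthPoly n C(K, ℝ)) 1) ↔
        (∃ t : K, P = OrthPoly.deltaPow hn t ∨ P = -OrthPoly.deltaPow hn t) ∨
        (∃ s t : K, s ≠ t ∧ P = OrthPoly.deltaPow hn s - OrthPoly.deltaPow hn t)) := by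
  refine ⟨fun h P => ?_, fun h P => ?_⟩ <;>
    obtain ⟨φ, rfl⟩ := (OrthPoly.functionalEquiv hn).surjective P
  · rw [LinearEquiv.apply_mem_extremePoints_iff _ (S := dualBall K)
      (OrthPoly.functionalEquiv_mem_closedBall_iff_of_odd hn h), mem_extremePoints_dualBall_iff]
    simp_rw [← OrthPoly.functionalEquiv_evalCLM, ← map_neg, EmbeddingLike.apply_eq_iff_eq]
  · rw [LinearEquiv.apply_mem_extremePoints_iff _ (S := intervalPolar K)
      (OrthPoly.functionalEquiv_mem_closedBall_iff_of_even hn h),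
      mem_extremePoints_intervalPolar_iff]
    simp_rw [← OrthPoly.functionalEquiv_evalCLM, ← map_neg, ← map_sub,
      EmbeddingLike.apply_eq_iff_eq]
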